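/- All graphs are finite, undirected and loopless, and may have multiple edges. A graph $H$ is a *contraction* of $G$ if there is a surjection $\sigma:V(G)\to V(H)$ such that $G[\sigma^{-1}(x)]$ is non-empty and connected for every $x\in V(H)$, and, for all distinct $x,y\in V(H)$, $x$ and $y$ are adjacent in $H$ if and only if $G[\sigma^{-1}(x)\cup\sigma^{-1}(y)]$ is connected. For an integer $t\ge 3$, the *uniformly triangulated grid* $\Gamma_t$ is the simple graph on $\{0,\dots,t-1\}^2$ obtained from the $(t\times t)$-grid by adding all edges $\{(i+1,j),(i,j+1)\}$, $0\le i,j\le t-2$, and joining $(t-1,t-1)$ to all other vertices $(i,j)$ with $i\in\{0,t-1\}$ or $j\in\{0,t-1\}$. For a real $c$ with $1\le c<2$, a class $\mathcal G$ of graphs is in $\mathrm{SQGC}(c)$ if there is a constant $\lambda$ such that for every $G\in\mathcal G$ and every integer $t\ge 3$, if $\Gamma_t$ is not a contraction of $G$ then the treewidth of $G$ is at most $\lambda t^c$. For a graph $G$ and a set $\mathcal C$ of subsets $S\subseteq V(G)$ with $G[S]$ (non-empty and) connected, the *intersection graph* $I_G(\mathcal C)$ has vertex set $\mathcal C$, and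 two distinct $A,B\in\mathcal C$ are joined by exactly $|A\cap B|$ parallel edges. For $d\in\mathbb N=\{0,1,2,\dots\}$, $\mathrm{inter}_d(\mathcal G)$ is the class of all graphs $I_G(\mathcal C)$, with $G\in\mathcal G$ and $\mathcal C$ as above, in which every vertex is incident to at most $d$ edges (counted with multiplicity). A class is *monotone* if it is closed under taking subgraphs. For a class $\mathcal G$ let $\mathcal G^{\mathrm{conn}}$ denote the class of its connected members. **Theorem.** Let $\mathcal G$ be a monotone graph class, let $1\le c<2$ and let $d\in\mathbb N$. 1. If $\mathcal G\in \mathrm{SQGC}(c)$, then $\mathrm{inter}_d(\mathcal G)\in\mathrm{SQGC}(c)$. 2. If $\mathcal G^{\mathrm{conn}}\in \mathrm{SQGC}(c)$, then $\mathrm{inter}_d(\mathcal G)^{\mathrm{conn}}\in\mathrm{SQGC}(c)$. -/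

import Mathlib

universe u

namespace SimpleGraph

/-- `H ≤ G` (`H` is a contraction of `G`): there is a surjection `σ : V(G) → V(H)` whose fibres
induce non-empty connected subgraphs of `G`, and two distinct vertices `x, y` of `H` are adjacent
if and only if `G[σ⁻¹(x) ∪ σ⁻¹(y)]` is connected. (For a finite graph, a subgraph has diameter at
most some integer exactly when it is connected. `Connected` includes non-emptiness.) -/
def IsContraction {V W : Type*} (H : SimpleGraph W) (G : SimpleGraph V) : Prop :=
  ∃ σ : V → W, Function.Surjective σ ∧
    (∀ x, (G.induce (σ ⁻¹' {x})).Connected) ∧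
    ∀ x y, x ≠ y → (H.Adj x y ↔ (G.induce (σ ⁻¹' {x} ∪ σ ⁻¹' {y})).Connected)

/-- `(T, X)` is a tree-decomposition of `G`. -/
structure IsTreeDecomposition {V ι : Type*} (G : SimpleGraph V) (T : SimpleGraph ι)
    (X : ι → Set V) : Prop where
  isTree : T.IsTree
  vertex_mem : ∀ v, ∃ t, v ∈ X t
  edge_mem : ∀ v w, G.Adj v w → ∃ t, v ∈ X t ∧ w ∈ X t
  connected : ∀ v, (T.induce {t | v ∈ X t}).Connected

/-- The treewidth of a finite graph: the least `w` such that there is a tree-decomposition, over a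
finite tree, all of whose bags have at most `w + 1` vertices. -/
noncomputable def treewidth {V : Type*} (G : SimpleGraph V) : ℕ :=
  sInf {w | ∃ (ι : Type) (_ : Finite ι) (T : SimpleGraph ι) (X : ι → Set V),
    G.IsTreeDecomposition T X ∧ ∀ t, (X t).encard ≤ w + 1}

/-- The uniformly triangulated grid `Γ_k` (for `k ≥ 3`), on the vertex set `[0, k-1]²`. -/
def triangulatedGrid (k : ℕ) : SimpleGraph (Fin k × Fin k) :=
  SimpleGraph.fromRel fun p q =>
    -- the edges of the `k × k` grid
    |(p.1 : ℤ) - (q.1 : ℤ)| + |(p.2 : ℤ) - (q.2 : ℤ)| = 1 ∨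
    -- the diagonals `{(i+1, j), (i, j+1)}`
    ((p.1 : ℕ) = q.1 + 1 ∧ (q.2 : ℕ) = p.2 + 1) ∨
    -- the edges from the corner `(k-1, k-1)` to all other boundary vertices
    (((p.1 : ℕ) + 1 = k ∧ (p.2 : ℕ) + 1 = k) ∧
      ((q.1 : ℕ) = 0 ∨ (q.1 : ℕ) + 1 = k ∨ (q.2 : ℕ) = 0 ∨ (q.2 : ℕ) + 1 = k))

end SimpleGraph

/-- Finite loopless graphs, possibly with multiple edges. -/
structure FinGraph : Type (u + 1) where
  {α : Type u}
  {β : Type u}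
  graph : Graph α β
  loopless : graph.Loopless
  finite_vertexSet : graph.vertexSet.Finite
  finite_edgeSet : graph.edgeSet.Finite

namespace FinGraph

/-- The underlying simple graph, on the vertex set of `G`. -/
def simple (G : FinGraph.{u}) : SimpleGraph G.graph.vertexSet := G.graph.toSimpleGraph

def Connected (G : FinGraph.{u}) : Prop := G.simple.Connected

/-- The treewidth of `G`; multiplicities of edges play no role. -/
noncomputable def treewidth (G : FinGraph.{u}) : ℕ := G.simple.treewidth

/-- The number of edges incident to `v`, counted with multiplicity. -/
noncomputable def edgeDegree (G : FinGraph.{u}) (v : G.α) : ℕ := (G.graph.incidenceSet v).ncard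

/-- A subgraph of a finite loopless graph, as a finite loopless graph. -/
def ofLE (G : FinGraph.{u}) (H : Graph G.α G.β) (h : H ≤ G.graph) : FinGraph.{u} where
  graph := H
  loopless := by
    have := G.loopless
    exact Graph.Loopless.anti h
  finite_vertexSet := G.finite_vertexSet.subset h.vertexSet_mono
  finite_edgeSet := G.finite_edgeSet.subset fun e he => by
    obtain ⟨x, y, hxy⟩ := Graph.exists_isLink_of_mem_edgeSet he
    exact (h.isLink_mono hxy).edge_mem

/-- The connected vertex sets of `G`: those `S ⊆ V(G)` for which `G[S]` is connected. -/
def connectedSets (G : FinGraph.{u}) : Set (Set G.graph.vertexSet) :=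
  {S | (G.simple.induce S).Connected}

/-- The intersection graph `I_G(𝒞)`: its vertices are the members of `𝒞`, and there is one edge
`(s(A, B), x)` between distinct `A, B ∈ 𝒞` for each `x ∈ A ∩ B`, so that the edge `{A, B}` has
multiplicity `|A ∩ B|`. -/
def intersectionGraph (G : FinGraph.{u}) (𝒞 : Set (Set G.graph.vertexSet)) : FinGraph.{u} where
  α := Set G.graph.vertexSet
  β := Sym2 (Set G.graph.vertexSet) × G.graph.vertexSet
  graph :=
    { vertexSet := 𝒞
      IsLink := fun e A B => A ∈ 𝒞 ∧ B ∈ 𝒞 ∧ A ≠ B ∧ e.1 = s(A, B) ∧ e.2 ∈ A ∩ B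
      isLink_symm := fun e _ => ⟨fun A B h =>
        ⟨h.2.1, h.1, h.2.2.1.symm, by rw [h.2.2.2.1, Sym2.eq_swap], h.2.2.2.2.symm⟩⟩
      eq_or_eq_of_isLink_of_isLink := by
        rintro e A B C D ⟨-, -, -, h, -⟩ ⟨-, -, -, h', -⟩
        rw [h, Sym2.eq_iff] at h'
        rcases h' with h' | h'
        · exact Or.inl h'.1
        · exact Or.inr h'.1
      left_mem_of_isLink := fun _ _ _ h => h.1 }
  loopless := ⟨fun _ _ h => h.2.2.1 rfl⟩
  finite_vertexSet := by
    have : Finite G.graph.vertexSet := G.finite_vertexSet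
    exact Set.toFinite _
  finite_edgeSet := by
    have : Finite G.graph.vertexSet := G.finite_vertexSet
    exact Set.toFinite _

/-- A class of graphs is monotone if it is closed under taking subgraphs. -/
def IsMonotone (𝒢 : Set FinGraph.{u}) : Prop :=
  ∀ G ∈ 𝒢, ∀ (H : Graph G.α G.β) (h : H ≤ G.graph), G.ofLE H h ∈ 𝒢

/-- `𝒢 ∈ SQGC(c)`: the graphs of `𝒢` excluding `Γ_t` as a contraction have treewidth `O(t^c)`. -/
def SQGC (c : ℝ) (𝒢 : Set FinGraph.{u}) : Prop :=
  ∃ C : ℝ, ∀ G ∈ 𝒢, ∀ t : ℕ, 3 ≤ t →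
    ¬ (SimpleGraph.triangulatedGrid t).IsContraction G.simple →
      (G.treewidth : ℝ) ≤ C * (t : ℝ) ^ c

/-- The class of all intersection graphs of connected vertex sets of graphs in `𝒢`. -/
def inter (𝒢 : Set FinGraph.{u}) : Set FinGraph.{u} :=
  {H | ∃ G ∈ 𝒢, ∃ 𝒞 ⊆ G.connectedSets, H = G.intersectionGraph 𝒞}

/-- The members of `inter 𝒢` of edge-degree at most `d`. -/
def interDeg (d : ℕ) (𝒢 : Set FinGraph.{u}) : Set FinGraph.{u} :=
  {H | H ∈ inter 𝒢 ∧ ∀ v ∈ H.graph.vertexSet, H.edgeDegree v ≤ d}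

/-- The connected members of a class of graphs. -/
def connectedMembers (𝒢 : Set FinGraph.{u}) : Set FinGraph.{u} :=
  {G | G ∈ 𝒢 ∧ G.Connected}

end FinGraph

/-!
# Intersection graphs of connected sets preserve `SQGC(c)`

Let `I` be the intersection graph of a family `𝒞` of connected vertex sets of `G`, with edge-degrees
at most `d`. Then a vertex of `G` lies in at most `d + 1` members of `𝒞`, and a member has at most
`d` *shared* vertices, that is, vertices lying in other members too. The graph `G` is replaced by a
subgraph `G'` on the union of `𝒞` that is edge-minimal with the property that all members stay
connected (`exists_minimal_connecting`). As the class is monotone, it contains `G'`, and `G'` is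
connected if `I` is. Two facts relate `I` to `G'` (`exists_subgraph_of_intersectionGraph`), and
`SQGC(c)` follows with a new constant (`SQGC.transfer`).

* The treewidth of `I` is at most `(d + 1) * (tw(G') + 1)`: in a tree-decomposition of `G'`, replace
  each vertex by the members containing it (`treewidth_le_of_cover`).
* For a constant `K = gridFactor d`, if `Γ_{Kt}` is a contraction of `G'`, then `Γ_t` is a
  contraction of `I` (`IsSparseCover.isContraction`).

For the second fact, let `σ` be a contraction map from `G'` to `Γ_s` with `s = K * t`, and let `Z A`
be the image of a member `A`. If a grid point of `Z A` is not the image of a shared vertex of `A`,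
then its fibre consists of private vertices of `A` and all its grid neighbours belong to `Z A`.
Three pairwise adjacent such points are impossible, because then an edge of `G'` between two of the
fibres would be redundant for the connectivity of `A`. Hence each pair of adjacent columns (or rows)
meeting `Z A` contains the image of one of the at most `d` shared vertices. It follows that `Z A`
has diameter at most `m = 3 * d` in the maximum norm, up to shortcuts along the boundary of the
square, all of which is adjacent to one corner (`IsSparseCover.isLocal_image`).

Now `Γ_t` is drawn coarsely in `Γ_s` as a brick wall with rows shifted by half a brick, the outside
of the wall being the core of the corner vertex (`isCoarseDrawing_brickCore`). Members of `𝒞` whose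
image touches the core of a vertex `i` of `Γ_t` get the label `i`. The remaining members touch only
the gaps between the cores. They are labelled along connected sets of members reaching from a point
in a gap to a core, so that label classes stay connected. The grid points are coloured by their
coordinates modulo `3 * m + 1` and treated in one round per colour. Points of one colour do not
interfere, so that a label moves away from its core by at most `3 * m` per round
(`exists_labelling_rounds`). If the bricks are large compared with the total drift, labels of
non-adjacent vertices of `Γ_t` never come together, while those of adjacent vertices meet in the
middle of the common side of their bricks. So the labelling is a contraction map from `I` to `Γ_t`
(`isContraction_of_isCoarseDrawing`).
-/

namespace SimpleGraph

/-! ### Connected vertex sets -/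

section ConnectedSets

variable {V W : Type*} {G : SimpleGraph V} {H : SimpleGraph W}

/-- Induction over a connected vertex set: a property that holds at one vertex and passes along the
edges inside the set holds on the whole set. -/
lemma Connected.induce_induction {X : Set V} (h : (G.induce X).Connected) {P : V → Prop} {r : V}
    (hr : r ∈ X) (hP : P r)
    (hstep : ∀ v w, v ∈ X → w ∈ X → G.Adj v w → P v → P w) {w : V} (hw : w ∈ X) : P w := by
  obtain ⟨p⟩ := h.preconnected ⟨r, hr⟩ ⟨w, hw⟩
  have : ∀ {a b : X}, (G.induce X).Walk a b → P a → P b := by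
    intro a b p
    induction p with
    | nil => exact id
    | cons hadj _ ih =>
      exact fun ha => ih (hstep _ _ (Subtype.coe_prop _) (Subtype.coe_prop _) hadj ha)
  exact this p hP

/-- The converse of `Connected.induce_induction`: it suffices to have the induction principle from
one root. -/
lemma induce_connected_of_induction {X : Set V} {r : V} (hr : r ∈ X)
    (h : ∀ P : V → Prop, P r → (∀ v w, v ∈ X → w ∈ X → G.Adj v w → P v → P w) →
      ∀ w ∈ X, P w) : (G.induce X).Connected := by
  rw [connected_iff_exists_forall_reachable]
  refine ⟨⟨r, hr⟩, fun ⟨w, hw⟩ => ?_⟩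
  have := h (fun v => ∃ hv : v ∈ X, (G.induce X).Reachable ⟨r, hr⟩ ⟨v, hv⟩) ⟨hr, Reachable.refl _⟩
    (fun v w hv hw hadj ⟨_, h'⟩ => ⟨hw, h'.trans (Adj.reachable (by simpa using hadj))⟩) w hw
  exact this.2

lemma Connected.induce_nonempty {X : Set V} (h : (G.induce X).Connected) : X.Nonempty := by
  obtain ⟨x⟩ := h.nonempty
  exact ⟨x, x.2⟩

lemma induce_singleton_connected (v : V) : (G.induce {v}).Connected :=
  induce_connected_of_induction (Set.mem_singleton v) fun P hP _ w hw => by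
    rw [Set.mem_singleton_iff] at hw
    exact hw ▸ hP

lemma Connected.exists_adj_of_mem_of_notMem {X Y : Set V} (h : (G.induce X).Connected) {a b : V}
    (ha : a ∈ X) (haY : a ∈ Y) (hb : b ∈ X) (hbY : b ∉ Y) :
    ∃ v ∈ X, ∃ w ∈ X, v ∈ Y ∧ w ∉ Y ∧ G.Adj v w := by
  by_contra! hcon
  exact hbY (h.induce_induction ha haY
    (fun v w hv hw hadj hvY => by_contra fun hwY => hcon v hv w hw hvY hwY hadj) hb)

lemma Connected.induce_insert {X : Set V} (h : (G.induce X).Connected) {a b : V} (hb : b ∈ X)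
    (hadj : G.Adj b a) : (G.induce (insert a X)).Connected := by
  refine induce_connected_of_induction (Set.mem_insert_of_mem _ hb) fun P hP hstep => ?_
  have hX : ∀ w ∈ X, P w := fun w hw => h.induce_induction hb hP
    (fun v w hv hw => hstep v w (Set.mem_insert_of_mem _ hv) (Set.mem_insert_of_mem _ hw)) hw
  rintro w (rfl | hw)
  · exact hstep _ _ (Set.mem_insert_of_mem _ hb) (Set.mem_insert _ _) hadj hP
  · exact hX w hw

lemma Connected.induce_union_of_adj {X Y : Set V} (hX : (G.induce X).Connected)
    (hY : (G.induce Y).Connected) {a b : V} (ha : a ∈ X) (hb : b ∈ Y) (hadj : G.Adj a b) :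
    (G.induce (X ∪ Y)).Connected := by
  refine induce_connected_of_induction (Or.inl ha) fun P hP hstep => ?_
  have hPb : P b := hstep _ _ (Or.inl ha) (Or.inr hb) hadj hP
  rintro w (hw | hw)
  · exact hX.induce_induction ha hP (fun v w hv hw => hstep v w (Or.inl hv) (Or.inl hw)) hw
  · exact hY.induce_induction hb hPb (fun v w hv hw => hstep v w (Or.inr hv) (Or.inr hw)) hw

/-- Two disjoint connected sets have a connected union exactly when an edge joins them. -/
lemma induce_union_connected_iff_exists_adj {X Y : Set V} (hX : (G.induce X).Connected)
    (hY : (G.induce Y).Connected) (hXY : ∀ v ∈ X, v ∉ Y) :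
    (G.induce (X ∪ Y)).Connected ↔ ∃ a ∈ X, ∃ b ∈ Y, G.Adj a b := by
  constructor
  · intro h
    obtain ⟨x, hx⟩ := hX.induce_nonempty
    obtain ⟨y, hy⟩ := hY.induce_nonempty
    obtain ⟨v, _, w, hw, hvX, hwX, hadj⟩ := h.exists_adj_of_mem_of_notMem (Y := X) (Or.inl hx) hx
      (Or.inr hy) (fun h' => hXY y h' hy)
    exact ⟨v, hvX, w, hw.resolve_left hwX, hadj⟩
  · rintro ⟨a, ha, b, hb, hadj⟩
    exact hX.induce_union_of_adj hY ha hb hadj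

/-- A contraction map, with adjacency expressed by edges between fibres. -/
lemma isContraction_of_fibers {σ : V → W}
    (hconn : ∀ x, (G.induce (σ ⁻¹' {x})).Connected)
    (hadj : ∀ x y, x ≠ y → (H.Adj x y ↔ ∃ a b, σ a = x ∧ σ b = y ∧ G.Adj a b)) :
    H.IsContraction G := by
  refine ⟨σ, fun x => ?_, hconn, fun x y hxy => ?_⟩
  · obtain ⟨a, ha⟩ := (hconn x).induce_nonempty
    exact ⟨a, ha⟩
  · rw [hadj x y hxy, induce_union_connected_iff_exists_adj (hconn x) (hconn y)]
    · constructor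
      · rintro ⟨a, b, ha, hb, h⟩
        exact ⟨a, ha, b, hb, h⟩
      · rintro ⟨a, ha, b, hb, h⟩
        exact ⟨a, b, ha, hb, h⟩
    · rintro v hv hv'
      exact hxy (hv.symm.trans hv')

/-- The preimage of a connected set under a contraction map is connected. -/
lemma induce_preimage_connected {σ : V → W}
    (hconn : ∀ x, (G.induce (σ ⁻¹' {x})).Connected)
    (hadj : ∀ x y, H.Adj x y → ∃ a b, σ a = x ∧ σ b = y ∧ G.Adj a b) {Q : Set W}
    (hQ : (H.induce Q).Connected) : (G.induce (σ ⁻¹' Q)).Connected := by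
  obtain ⟨q, hq⟩ := hQ.induce_nonempty
  obtain ⟨r, hr⟩ := (hconn q).induce_nonempty
  have hrq : σ r = q := hr
  refine induce_connected_of_induction (r := r) (by simpa [hrq] using hq) fun P hP hstep => ?_
  -- A closed property that holds at one vertex of a fibre holds on the whole fibre.
  have hfib : ∀ a b, σ a ∈ Q → σ a = σ b → P a → P b := fun a b ha hab hPa =>
    (hconn (σ a)).induce_induction (r := a) rfl hPa
      (fun v w (hv : σ v = σ a) (hw : σ w = σ a) => hstep v w (show σ v ∈ Q from hv ▸ ha)
        (show σ w ∈ Q from hw ▸ ha)) hab.symm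
  have key : ∀ w ∈ Q, ∀ b, σ b = w → P b := by
    intro w hw
    refine hQ.induce_induction (P := fun w => ∀ b, σ b = w → P b) hq
      (fun b hb => hfib r b (hrq ▸ hq) (hrq.trans hb.symm) hP) ?_ hw
    intro v w hv hw hvw hPv b hb
    obtain ⟨a, c, ha, hc, hac⟩ := hadj v w hvw
    have hca : P c := hstep a c (show σ a ∈ Q from ha ▸ hv) (show σ c ∈ Q from hc ▸ hw) hac
      (hPv a ha)
    exact hfib c b (hc ▸ hw) (hc.trans hb.symm) hca
  exact fun w hw => key _ hw w rfl

end ConnectedSets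

/-! ### Extending partial labellings with connected classes -/

section Labelling

variable {W L : Type*} {H : SimpleGraph W}

/-- A partial labelling with connected label classes extends over a connected set that already has a
labelled vertex, using only labels that occur in that set. -/
lemma exists_extend_labelling [Finite W] {S : Set W} (hS : (H.induce S).Connected)
    (f : W → Option L) (hf : ∀ i, (H.induce {A | f A = some i}).Connected)
    (hSf : ∃ A ∈ S, f A ≠ none) :
    ∃ f' : W → Option L, (∀ A i, f A = some i → f' A = some i) ∧
      (∀ i, (H.induce {A | f' A = some i}).Connected) ∧ (∀ A ∈ S, f' A ≠ none) ∧
      ∀ A i, f' A = some i → f A = some i ∨ A ∈ S ∧ ∃ B ∈ S, f B = some i := by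
  classical
  induction hn : {A ∈ S | f A = none}.ncard using Nat.strong_induction_on generalizing f with
  | _ n ih =>
    by_cases hall : ∀ A ∈ S, f A ≠ none
    · exact ⟨f, fun _ _ h => h, hf, hall, fun _ _ h => Or.inl h⟩
    push Not at hall
    obtain ⟨A₀, hA₀, hA₀f⟩ := hall
    obtain ⟨B₀, hB₀, hB₀f⟩ := hSf
    obtain ⟨B, hB, A, hA, hBf, hAf, hadj⟩ := hS.exists_adj_of_mem_of_notMem
      (Y := {A | f A ≠ none}) hB₀ hB₀f hA₀ (by simpa using hA₀f)
    simp only [Set.mem_ofPred_eq, not_not] at hBf hAf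
    obtain ⟨j, hj⟩ := Option.ne_none_iff_exists'.1 hBf
    have hBA : B ≠ A := fun h => hBf (h ▸ hAf)
    obtain ⟨f', h1, h2, h3, h4⟩ := ih ({C ∈ S | Function.update f A (some j) C = none}.ncard)
      (by
        rw [← hn]
        refine Set.ncard_lt_ncard ⟨fun C hC => ⟨hC.1, ?_⟩, fun h => ?_⟩ (Set.toFinite _)
        · have := hC.2
          by_cases hCA : C = A
          · rwa [hCA]
          · rwa [Function.update_of_ne hCA] at this
        · have := (h (show A ∈ {A ∈ S | f A = none} from ⟨hA, hAf⟩)).2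
          simp at this)
      (Function.update f A (some j)) (fun i => by
        by_cases hij : i = j
        · subst hij
          have : {C | Function.update f A (some i) C = some i} = insert A {C | f C = some i} := by
            ext C
            by_cases hCA : C = A <;> simp [hCA, Function.update_of_ne]
          rw [this]
          exact (hf i).induce_insert hj hadj
        · have : {C | Function.update f A (some j) C = some i} = {C | f C = some i} := by
            ext C
            by_cases hCA : C = A
            · simp [hCA, hAf, Ne.symm hij]
            · simp [Function.update_of_ne hCA]
          rw [this]
          exact hf i)
      ⟨A, hA, by simp⟩ rfl
    refine ⟨f', fun C i hC => h1 C i ?_, h2, h3, fun C i hC => ?_⟩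
    · rw [Function.update_of_ne]
      · exact hC
      · rintro rfl
        simp [hAf] at hC
    · have hlab : ∀ D, Function.update f A (some j) D = some i →
          f D = some i ∨ D = A ∧ f B = some i := by
        intro D hD
        by_cases hDA : D = A
        · subst hDA
          simp only [Function.update_self, Option.some.injEq] at hD
          exact Or.inr ⟨rfl, hD ▸ hj⟩
        · rw [Function.update_of_ne hDA] at hD
          exact Or.inl hD
      rcases h4 C i hC with h | ⟨hCS, D, hDS, hD⟩
      · rcases hlab C h with h' | ⟨hCA, h'⟩
        · exact Or.inl h'
        · exact Or.inr ⟨hCA ▸ hA, B, hB, h'⟩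
      · rcases hlab D hD with h' | ⟨-, h'⟩
        · exact Or.inr ⟨hCS, D, hDS, h'⟩
        · exact Or.inr ⟨hCS, B, hB, h'⟩

/-- Simultaneous extension over a family of connected sets that are disjoint outside the labelled
vertices: every new label comes from an originally labelled vertex of the same set. -/
lemma exists_extend_labelling_family [Finite W] {ι : Type*} (P : Finset ι) (S : ι → Set W)
    (hS : ∀ p ∈ P, (H.induce (S p)).Connected) (f : W → Option L)
    (hf : ∀ i, (H.induce {A | f A = some i}).Connected) (hSf : ∀ p ∈ P, ∃ A ∈ S p, f A ≠ none)
    (hdisj : ∀ p ∈ P, ∀ q ∈ P, p ≠ q → ∀ A ∈ S p, A ∈ S q → f A ≠ none) :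
    ∃ f' : W → Option L, (∀ A i, f A = some i → f' A = some i) ∧
      (∀ i, (H.induce {A | f' A = some i}).Connected) ∧ (∀ p ∈ P, ∀ A ∈ S p, f' A ≠ none) ∧
      ∀ A i, f' A = some i → f A = some i ∨ ∃ p ∈ P, A ∈ S p ∧ ∃ B ∈ S p, f B = some i := by
  classical
  induction P using Finset.induction_on with
  | empty => exact ⟨f, fun _ _ h => h, hf, by simp, fun _ _ h => Or.inl h⟩
  | insert p P hp ih =>
    obtain ⟨g, g1, g2, g3, g4⟩ := ih (fun q hq => hS q (Finset.mem_insert_of_mem hq))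
      (fun q hq => hSf q (Finset.mem_insert_of_mem hq))
      (fun q hq r hr => hdisj q (Finset.mem_insert_of_mem hq) r (Finset.mem_insert_of_mem hr))
    obtain ⟨f', h1, h2, h3, h4⟩ := exists_extend_labelling (hS p (Finset.mem_insert_self _ _)) g g2
      (by
        obtain ⟨A, hA, hAf⟩ := hSf p (Finset.mem_insert_self _ _)
        obtain ⟨i, hi⟩ := Option.ne_none_iff_exists'.1 hAf
        exact ⟨A, hA, by simp [g1 A i hi]⟩)
    refine ⟨f', fun A i h => h1 A i (g1 A i h), h2, ?_, ?_⟩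
    · intro q hq A hA
      rcases Finset.mem_insert.1 hq with rfl | hq
      · exact h3 A hA
      · obtain ⟨i, hi⟩ := Option.ne_none_iff_exists'.1 (g3 q hq A hA)
        simp [h1 A i hi]
    · intro A i hA
      rcases h4 A i hA with h | ⟨hAS, B, hB, hBi⟩
      · rcases g4 A i h with h | ⟨q, hq, h⟩
        · exact Or.inl h
        · exact Or.inr ⟨q, Finset.mem_insert_of_mem hq, h⟩
      · refine Or.inr ⟨p, Finset.mem_insert_self _ _, hAS, B, hB, ?_⟩
        rcases g4 B i hBi with h | ⟨q, hq, hBq, -⟩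
        · exact h
        · -- `B` lies in two sets of the family, so it was labelled from the start.
          have hne := hdisj p (Finset.mem_insert_self _ _) q (Finset.mem_insert_of_mem hq)
            (fun h => hp (h ▸ hq)) B hB hBq
          obtain ⟨j, hj⟩ := Option.ne_none_iff_exists'.1 hne
          rw [← hBi, g1 B j hj, hj]

end Labelling

/-! ### Labelling a graph spread over a grid -/

section GridLabelling

/-- The points `p` and `q` of the square `[0, s-1]²` have distance at most `r` in the maximum
norm. -/
def Near {s : ℕ} (r : ℕ) (p q : Fin s × Fin s) : Prop :=
  (p.1 : ℕ) ≤ q.1 + r ∧ (q.1 : ℕ) ≤ p.1 + r ∧ (p.2 : ℕ) ≤ q.2 + r ∧ (q.2 : ℕ) ≤ p.2 + r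

lemma Near.symm {s r : ℕ} {p q : Fin s × Fin s} (h : Near r p q) : Near r q p :=
  ⟨h.2.1, h.1, h.2.2.2, h.2.2.1⟩

lemma Near.trans {s r r' : ℕ} {p q o : Fin s × Fin s} (h : Near r p q) (h' : Near r' q o) :
    Near (r + r') p o := by
  unfold Near at *
  omega

lemma Near.mono {s r r' : ℕ} {p q : Fin s × Fin s} (h : Near r p q) (hr : r ≤ r') :
    Near r' p q := by
  unfold Near at *
  omega

lemma near_refl {s : ℕ} (r : ℕ) (p : Fin s × Fin s) : Near r p p := by
  unfold Near
  omega

/-- The boundary of the square `[0, s-1]²`. In the triangulated grid the corner `(s-1, s-1)` is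
adjacent to all of it, so it is connected, and its points may be close in the graph without being
`Near`. -/
def frame (s : ℕ) : Set (Fin s × Fin s) :=
  {p | (p.1 : ℕ) = 0 ∨ (p.1 : ℕ) + 1 = s ∨ (p.2 : ℕ) = 0 ∨ (p.2 : ℕ) + 1 = s}

/-- A set of grid points has maximum-norm diameter at most `m`, except that it may use the boundary
of the square as a shortcut. -/
def IsLocal {s : ℕ} (m : ℕ) (Z : Set (Fin s × Fin s)) : Prop :=
  ∀ a ∈ Z, ∀ b ∈ Z, Near m a b ∨
    (∃ o ∈ frame s, o ∈ Z) ∧ (∃ o ∈ frame s, Near m a o) ∧ ∃ o ∈ frame s, Near m b o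

/-- A coarse drawing of the triangulated grid `Γ_t` in `Γ_s`: each vertex `i` of `Γ_t` has a
connected core `Q i`, the cores are pairwise at distance more than `m`, everything is within
distance `m` of a core, non-adjacent vertices have cores at distance more than `2 * R`, and the
cores of adjacent vertices are linked by a connected set at distance more than `R` from all other
cores. One core contains the boundary of the square. -/
structure IsCoarseDrawing {s t : ℕ} (m R : ℕ) (Q : Fin t × Fin t → Set (Fin s × Fin s)) : Prop where
  connected : ∀ i, ((triangulatedGrid s).induce (Q i)).Connected
  separated : ∀ i j, i ≠ j → ∀ p ∈ Q i, ∀ q ∈ Q j, ¬ Near m p q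
  frame_subset : ∃ i, frame s ⊆ Q i
  reach : ∀ p, ∃ X : Set (Fin s × Fin s), p ∈ X ∧ ((triangulatedGrid s).induce X).Connected ∧
    (∀ q ∈ X, Near m p q) ∧ ∃ i, ∃ q ∈ Q i, q ∈ X
  far : ∀ i j, i ≠ j → ¬ (triangulatedGrid t).Adj i j → ∀ p ∈ Q i, ∀ q ∈ Q j, ¬ Near (2 * R) p q
  link : ∀ i j, (triangulatedGrid t).Adj i j → ∃ X : Set (Fin s × Fin s),
    ((triangulatedGrid s).induce X).Connected ∧ (∃ q ∈ Q i, q ∈ X) ∧ (∃ q ∈ Q j, q ∈ X) ∧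
    ∀ k, k ≠ i → k ≠ j → ∀ p ∈ X, ∀ q ∈ Q k, ¬ Near R p q

/-- The distance that labels may drift away from their cores during the `(3 * m + 1) ^ 2` rounds of
the labelling process. -/
def driftBound (m : ℕ) : ℕ := m + (3 * m + 1) ^ 2 * (3 * m)

/-- The colour of a grid point, given by its residues modulo `M`. -/
def gridColour {s : ℕ} (M : ℕ) (p : Fin s × Fin s) : ℕ := (p.1 : ℕ) % M * M + (p.2 : ℕ) % M

lemma gridColour_lt {s M : ℕ} (hM : 0 < M) (p : Fin s × Fin s) : gridColour M p < M ^ 2 := by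
  have h1 := Nat.mod_lt (p.1 : ℕ) hM
  have h2 := Nat.mod_lt (p.2 : ℕ) hM
  unfold gridColour
  nlinarith

lemma eq_of_gridColour_eq_of_near {s r : ℕ} {p q : Fin s × Fin s}
    (h : gridColour (r + 1) p = gridColour (r + 1) q) (hpq : Near r p q) : p = q := by
  have hmod : ∀ a b : ℕ, a % (r + 1) = b % (r + 1) → a ≤ b + r → b ≤ a + r → a = b := by
    intro a b hab h1 h2
    rcases le_total a b with hle | hle
    · have := (Nat.modEq_iff_dvd' hle).1 hab
      have := Nat.eq_zero_of_dvd_of_lt this (by omega)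
      omega
    · have := (Nat.modEq_iff_dvd' hle).1 hab.symm
      have := Nat.eq_zero_of_dvd_of_lt this (by omega)
      omega
  have key : ∀ x y x' y' : ℕ, y < r + 1 → y' < r + 1 → x * (r + 1) + y = x' * (r + 1) + y' →
      x = x' ∧ y = y' := by
    intro x y x' y' hy hy' hxy
    have hx : x = x' := by
      have h1 : (x * (r + 1) + y) / (r + 1) = x := by
        rw [Nat.add_comm, Nat.add_mul_div_right _ _ (Nat.succ_pos r), Nat.div_eq_of_lt hy, zero_add]
      have h2 : (x' * (r + 1) + y') / (r + 1) = x' := by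
        rw [Nat.add_comm, Nat.add_mul_div_right _ _ (Nat.succ_pos r), Nat.div_eq_of_lt hy',
          zero_add]
      rw [← h1, ← h2, hxy]
    exact ⟨hx, by subst hx; omega⟩
  obtain ⟨h1, h2⟩ := key _ _ _ _ (Nat.mod_lt _ (Nat.succ_pos r)) (Nat.mod_lt _ (Nat.succ_pos r)) h
  obtain ⟨n1, n2, n3, n4⟩ := hpq
  exact Prod.ext (Fin.ext (hmod _ _ h1 n1 n2)) (Fin.ext (hmod _ _ h2 n3 n4))

variable {W : Type*} {H : SimpleGraph W} {s t m : ℕ}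
  {Z : W → Set (Fin s × Fin s)} {Q : Fin t × Fin t → Set (Fin s × Fin s)} {R : ℕ}

/-- The seeds of the labelling: the vertices that touch a core are labelled by it. -/
lemma exists_seed_labelling
    (htouch : ∀ X : Set (Fin s × Fin s), ((triangulatedGrid s).induce X).Connected →
      (H.induce {A | (Z A ∩ X).Nonempty}).Connected)
    (hloc : ∀ A, IsLocal m (Z A)) (hQ : IsCoarseDrawing m R Q) :
    ∃ f : W → Option (Fin t × Fin t),
      (∀ A i, f A = some i ↔ (Z A ∩ Q i).Nonempty) ∧
      (∀ i, (H.induce {A | f A = some i}).Connected) ∧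
      ∀ A i, f A = some i → ∀ a ∈ Z A, ∃ q ∈ Q i, Near m a q := by
  classical
  obtain ⟨i₀, hi₀⟩ := hQ.frame_subset
  have huniq : ∀ A i j, (Z A ∩ Q i).Nonempty → (Z A ∩ Q j).Nonempty → i = j := by
    rintro A i j ⟨a, ha, hai⟩ ⟨b, hb, hbj⟩
    by_contra hij
    rcases hloc A a ha b hb with h | ⟨-, ⟨o, ho, hao⟩, o', ho', hbo⟩
    · exact hQ.separated i j hij a hai b hbj h
    · by_cases hi : i = i₀
      · exact hQ.separated j i₀ (fun h => hij (hi.trans h.symm)) b hbj o' (hi₀ ho') hbo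
      · exact hQ.separated i i₀ hi a hai o (hi₀ ho) hao
  obtain ⟨f, hf⟩ : ∃ f : W → Option (Fin t × Fin t), ∀ A i, f A = some i ↔
      (Z A ∩ Q i).Nonempty := by
    refine ⟨fun A => if h : ∃ i, (Z A ∩ Q i).Nonempty then some h.choose else none,
      fun A i => ?_⟩
    dsimp only
    split_ifs with h
    · rw [Option.some.injEq]
      exact ⟨fun hi => hi ▸ h.choose_spec, fun hi => huniq A _ _ h.choose_spec hi⟩
    · exact ⟨fun h' => by simp at h', fun h' => (h ⟨i, h'⟩).elim⟩
  refine ⟨f, hf, fun i => ?_, fun A i hA a ha => ?_⟩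
  · have hfib : {A | f A = some i} = {A | (Z A ∩ Q i).Nonempty} := Set.ext fun A => hf A i
    rw [hfib]
    exact htouch _ (hQ.connected i)
  · obtain ⟨b, hb, hbi⟩ := (hf A i).1 hA
    rcases hloc A a ha b hb with h | ⟨-, ⟨o, ho, hao⟩, o', ho', hbo⟩
    · exact ⟨b, hbi, h⟩
    · by_cases hi : i = i₀
      · exact ⟨o, hi ▸ hi₀ ho, hao⟩
      · exact (hQ.separated i i₀ hi b hbi o' (hi₀ ho') hbo).elim

/-- The labelling process: after `k` rounds, all vertices touching a point of colour less than `k`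
are labelled, and no label has drifted away from its core by more than `3 * m` per round. Points of
the same colour are so far apart that they do not interfere within one round. -/
lemma exists_labelling_rounds [Finite W]
    (htouch : ∀ X : Set (Fin s × Fin s), ((triangulatedGrid s).induce X).Connected →
      (H.induce {A | (Z A ∩ X).Nonempty}).Connected)
    (hloc : ∀ A, IsLocal m (Z A)) (hQ : IsCoarseDrawing m R Q) (k : ℕ) :
    ∃ f : W → Option (Fin t × Fin t),
      (∀ A i, (Z A ∩ Q i).Nonempty → f A = some i) ∧
      (∀ i, (H.induce {A | f A = some i}).Connected) ∧
      (∀ A i, f A = some i → ∀ a ∈ Z A, ∃ q ∈ Q i, Near (m + k * (3 * m)) a q) ∧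
      ∀ A, ∀ p ∈ Z A, gridColour (3 * m + 1) p < k → f A ≠ none := by
  classical
  obtain ⟨i₀, hi₀⟩ := hQ.frame_subset
  induction k with
  | zero =>
    obtain ⟨f, h1, h2, h3⟩ := exists_seed_labelling htouch hloc hQ
    exact ⟨f, fun A i => (h1 A i).2, h2, by simpa using h3, by simp⟩
  | succ k ih =>
    obtain ⟨f, h1, h2, h3, h4⟩ := ih
    choose X hpX hXc hXn hXQ using hQ.reach
    -- A vertex without a label does not touch the boundary, so it is small in the maximum norm.
    have hsmall : ∀ A, f A = none → ∀ a ∈ Z A, ∀ b ∈ Z A, Near m a b := by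
      intro A hA a ha b hb
      rcases hloc A a ha b hb with h | ⟨⟨o, ho, hoA⟩, -⟩
      · exact h
      · have := h1 A i₀ ⟨o, hoA, hi₀ ho⟩
        simp [hA] at this
    obtain ⟨g, g1, g2, g3, g4⟩ := exists_extend_labelling_family
      (Finset.univ.filter fun p : Fin s × Fin s => gridColour (3 * m + 1) p = k)
      (fun p => {A | (Z A ∩ X p).Nonempty}) (fun p _ => htouch _ (hXc p)) f h2
      (by
        intro p _
        obtain ⟨i, q, hqi, hqX⟩ := hXQ p
        obtain ⟨A, hA⟩ := (htouch {q} (induce_singleton_connected q)).induce_nonempty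
        obtain ⟨o, hoA, rfl⟩ := hA
        exact ⟨A, ⟨o, hoA, hqX⟩, by simp [h1 A i ⟨o, hoA, hqi⟩]⟩)
      (by
        rintro p hp q hq hpq A ⟨a, ha, hap⟩ ⟨b, hb, hbq⟩ hA
        rw [Finset.mem_filter] at hp hq
        refine hpq (eq_of_gridColour_eq_of_near (hp.2.trans hq.2.symm) ?_)
        exact (((hXn p a hap).trans (hsmall A hA a ha b hb)).trans (hXn q b hbq).symm).mono
          (by omega))
    refine ⟨g, fun A i h => g1 A i (h1 A i h), g2, ?_, ?_⟩
    · intro A i hA a ha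
      have hk : (k + 1) * (3 * m) = k * (3 * m) + 3 * m := by ring
      have hle : m + k * (3 * m) ≤ m + (k + 1) * (3 * m) := by
        omega
      by_cases hfA : f A = none
      · rcases g4 A i hA with h | ⟨p, -, ⟨b, hb, hbp⟩, B, ⟨c, hc, hcp⟩, hBi⟩
        · simp [hfA] at h
        · obtain ⟨q, hq, hcq⟩ := h3 B i hBi c hc
          refine ⟨q, hq, ?_⟩
          refine ((((hsmall A hfA a ha b hb).trans (hXn p b hbp).symm).trans
            (hXn p c hcp)).trans hcq).mono ?_
          omega
      · obtain ⟨j, hj⟩ := Option.ne_none_iff_exists'.1 hfA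
        have hji : j = i := by
          have := g1 A j hj
          rwa [hA, Option.some.injEq, eq_comm] at this
        obtain ⟨q, hq, haq⟩ := h3 A j hj a ha
        exact ⟨q, hji ▸ hq, haq.mono hle⟩
    · intro A p hp hpk
      rcases Nat.lt_succ_iff_lt_or_eq.1 hpk with h | h
      · obtain ⟨j, hj⟩ := Option.ne_none_iff_exists'.1 (h4 A p hp h)
        simp [g1 A j hj]
      · exact g3 p (by simp [h]) A ⟨p, hp, hpX p⟩

/-- If the vertices of `H` occupy local sets of grid points, so that connected sets of points are
touched by connected sets of vertices and adjacent vertices share a point, then a coarse drawing of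
`Γ_t` in the grid makes `Γ_t` a contraction of `H`. -/
theorem isContraction_of_isCoarseDrawing [Finite W]
    (hadj : ∀ A B, H.Adj A B → (Z A ∩ Z B).Nonempty)
    (htouch : ∀ X : Set (Fin s × Fin s), ((triangulatedGrid s).induce X).Connected →
      (H.induce {A | (Z A ∩ X).Nonempty}).Connected)
    (hZ : ∀ A, (Z A).Nonempty)
    (hloc : ∀ A, IsLocal m (Z A)) (hQ : IsCoarseDrawing m (driftBound m) Q) :
    (triangulatedGrid t).IsContraction H := by
  obtain ⟨f, h1, h2, h3, h4⟩ := exists_labelling_rounds htouch hloc hQ ((3 * m + 1) ^ 2)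
  have hsome : ∀ A, ∃ i, f A = some i := fun A => by
    obtain ⟨p, hp⟩ := hZ A
    exact Option.ne_none_iff_exists'.1 (h4 A p hp (gridColour_lt (Nat.succ_pos _) p))
  choose σ hσ using hsome
  have hσi : ∀ A i, σ A = i ↔ f A = some i := fun A i => by
    rw [hσ, Option.some.injEq]
  have hnear : ∀ A, ∀ a ∈ Z A, ∃ q ∈ Q (σ A), Near (driftBound m) a q :=
    fun A a ha => h3 A _ (hσ A) a ha
  refine isContraction_of_fibers (σ := σ) (fun i => ?_) (fun i j hij => ⟨fun h => ?_, ?_⟩)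
  · have : σ ⁻¹' {i} = {A | f A = some i} := by
      ext A
      exact hσi A i
    rw [this]
    exact h2 i
  · obtain ⟨X, hX, ⟨p, hpi, hpX⟩, ⟨q, hqj, hqX⟩, hother⟩ := hQ.link i j h
    have hcon := htouch X hX
    have hget : ∀ p ∈ X, ∀ k, p ∈ Q k → ∃ A, (Z A ∩ X).Nonempty ∧ σ A = k := by
      intro p hpX k hpk
      obtain ⟨A, hA⟩ := (htouch {p} (induce_singleton_connected p)).induce_nonempty
      obtain ⟨o, hoA, rfl⟩ := hA
      exact ⟨A, ⟨o, hoA, hpX⟩, (hσi A k).2 (h1 A k ⟨o, hoA, hpk⟩)⟩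
    obtain ⟨A, hAX, hA⟩ := hget p hpX i hpi
    obtain ⟨B, hBX, hB⟩ := hget q hqX j hqj
    obtain ⟨C, hC, D, hD, hCi, hDi, hCD⟩ := hcon.exists_adj_of_mem_of_notMem (Y := {A | σ A = i})
      hAX hA hBX (fun h' => hij (h'.symm.trans hB))
    refine ⟨C, D, hCi, ?_, hCD⟩
    by_contra hDj
    obtain ⟨a, haD, haX⟩ := hD
    obtain ⟨q, hq, haq⟩ := hnear D a haD
    exact hother _ hDi hDj a haX q hq haq
  · rintro ⟨A, B, rfl, rfl, hAB⟩
    by_contra hnot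
    obtain ⟨z, hzA, hzB⟩ := hadj A B hAB
    obtain ⟨p, hp, hzp⟩ := hnear A z hzA
    obtain ⟨q, hq, hzq⟩ := hnear B z hzB
    exact hQ.far _ _ hij hnot p hp q hq ((hzp.symm.trans hzq).mono (by omega))

end GridLabelling

/-! ### The triangulated grid -/

section Grid

variable {s t : ℕ}

lemma near_one_or_mem_frame_of_adj {p q : Fin s × Fin s} (h : (triangulatedGrid s).Adj p q) :
    Near 1 p q ∨ p ∈ frame s ∧ q ∈ frame s := by
  simp only [triangulatedGrid, fromRel_adj, abs_eq_max_neg] at h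
  simp only [Near, frame, Set.mem_ofPred_eq]
  omega

lemma adj_of_fst_eq_add_one {p q : Fin s × Fin s} (h : (q.1 : ℕ) = p.1 + 1)
    (h' : (q.2 : ℕ) = p.2) : (triangulatedGrid s).Adj p q := by
  simp only [triangulatedGrid, fromRel_adj, abs_eq_max_neg, ne_eq, Prod.ext_iff, Fin.ext_iff]
  omega

lemma adj_of_snd_eq_add_one {p q : Fin s × Fin s} (h : (q.2 : ℕ) = p.2 + 1)
    (h' : (q.1 : ℕ) = p.1) : (triangulatedGrid s).Adj p q := by
  simp only [triangulatedGrid, fromRel_adj, abs_eq_max_neg, ne_eq, Prod.ext_iff, Fin.ext_iff]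
  omega

lemma adj_diagonal {p q : Fin s × Fin s} (h : (p.1 : ℕ) = q.1 + 1)
    (h' : (q.2 : ℕ) = p.2 + 1) : (triangulatedGrid s).Adj p q := by
  simp only [triangulatedGrid, fromRel_adj, abs_eq_max_neg, ne_eq, Prod.ext_iff, Fin.ext_iff]
  omega

/-- The rectangle `[x₀, x₁] × [y₀, y₁]` of grid points. -/
def rect (s x₀ x₁ y₀ y₁ : ℕ) : Set (Fin s × Fin s) :=
  {p | x₀ ≤ (p.1 : ℕ) ∧ (p.1 : ℕ) ≤ x₁ ∧ y₀ ≤ (p.2 : ℕ) ∧ (p.2 : ℕ) ≤ y₁}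

/-- A property that passes along the edges inside `X` passes along horizontal segments in `X`. -/
lemma iff_of_horizontal_segment {X : Set (Fin s × Fin s)} {P : Fin s × Fin s → Prop}
    (hP : ∀ v w, v ∈ X → w ∈ X → (triangulatedGrid s).Adj v w → P v → P w) {p q : Fin s × Fin s}
    (hy : p.2 = q.2) (hx : (p.1 : ℕ) ≤ q.1)
    (hX : ∀ o : Fin s × Fin s, o.2 = p.2 → (p.1 : ℕ) ≤ o.1 → (o.1 : ℕ) ≤ q.1 → o ∈ X) :
    P p ↔ P q := by
  obtain ⟨n, hn⟩ := Nat.exists_eq_add_of_le hx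
  induction n generalizing q with
  | zero =>
    have : p = q := Prod.ext (Fin.ext (by omega)) hy
    rw [this]
  | succ n ih =>
    have hlt : (p.1 : ℕ) + n < s := by omega
    have hadj : (triangulatedGrid s).Adj (⟨p.1 + n, hlt⟩, p.2) q :=
      adj_of_fst_eq_add_one (by simp only; omega) (by simp [hy])
    have h1 := hX (⟨p.1 + n, hlt⟩, p.2) rfl (by simp) (by simp; omega)
    have h2 := hX q hy.symm hx le_rfl
    rw [ih (q := (⟨p.1 + n, hlt⟩, p.2)) rfl (by simp)
      (fun o h h' h'' => hX o h h' (by simp at h''; omega)) rfl]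
    exact ⟨hP _ _ h1 h2 hadj, hP _ _ h2 h1 hadj.symm⟩

lemma iff_of_vertical_segment {X : Set (Fin s × Fin s)} {P : Fin s × Fin s → Prop}
    (hP : ∀ v w, v ∈ X → w ∈ X → (triangulatedGrid s).Adj v w → P v → P w) {p q : Fin s × Fin s}
    (hx : p.1 = q.1) (hy : (p.2 : ℕ) ≤ q.2)
    (hX : ∀ o : Fin s × Fin s, o.1 = p.1 → (p.2 : ℕ) ≤ o.2 → (o.2 : ℕ) ≤ q.2 → o ∈ X) :
    P p ↔ P q := by
  obtain ⟨n, hn⟩ := Nat.exists_eq_add_of_le hy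
  induction n generalizing q with
  | zero =>
    have : p = q := Prod.ext hx (Fin.ext (by omega))
    rw [this]
  | succ n ih =>
    have hlt : (p.2 : ℕ) + n < s := by omega
    have hadj : (triangulatedGrid s).Adj (p.1, ⟨p.2 + n, hlt⟩) q :=
      adj_of_snd_eq_add_one (by simp only; omega) (by simp [hx])
    have h1 := hX (p.1, ⟨p.2 + n, hlt⟩) rfl (by simp) (by simp; omega)
    have h2 := hX q hx.symm hy le_rfl
    rw [ih (q := (p.1, ⟨p.2 + n, hlt⟩)) rfl (by simp)
      (fun o h h' h'' => hX o h h' (by simp at h''; omega)) rfl]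
    exact ⟨hP _ _ h1 h2 hadj, hP _ _ h2 h1 hadj.symm⟩

lemma rect_connected {x₀ x₁ y₀ y₁ : ℕ} (hx : x₀ ≤ x₁) (hy : y₀ ≤ y₁) (hx₁ : x₁ < s)
    (hy₁ : y₁ < s) : ((triangulatedGrid s).induce (rect s x₀ x₁ y₀ y₁)).Connected := by
  have hx₀ : x₀ < s := by omega
  have hy₀ : y₀ < s := by omega
  refine induce_connected_of_induction (r := (⟨x₀, hx₀⟩, ⟨y₀, hy₀⟩)) (by simp [rect, hx, hy]) ?_
  rintro P hP hstep p ⟨h1, h2, h3, h4⟩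
  have hq : P (⟨x₀, hx₀⟩, p.2) := by
    refine (iff_of_vertical_segment hstep (p := (⟨x₀, hx₀⟩, ⟨y₀, hy₀⟩))
      (q := (⟨x₀, hx₀⟩, p.2)) rfl h3 ?_).1 hP
    rintro ⟨o₁, o₂⟩ rfl h5 h6
    simp only at h5 h6
    simp only [rect, Set.mem_ofPred_eq]
    omega
  refine (iff_of_horizontal_segment hstep (p := (⟨x₀, hx₀⟩, p.2)) (q := p) rfl h1 ?_).1 hq
  rintro ⟨o₁, o₂⟩ rfl h5 h6
  simp only at h5 h6
  simp only [rect, Set.mem_ofPred_eq]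
  omega

end Grid

/-! ### A coarse drawing by bricks -/

section Bricks

variable {s t e m : ℕ}

/-- The corner `(t-1, t-1)` of the triangulated grid `Γ_t`. -/
def IsCorner (i : Fin t × Fin t) : Prop := (i.1 : ℕ) + 1 = t ∧ (i.2 : ℕ) + 1 = t

/-- The brick of `i = (a, b)`: a square of side `4 * e` in the `b`-th row of a brick wall, in which
each row is shifted by half a brick with respect to the row below. So the bricks meeting that of
`(a, b)` in the next row are those of `(a, b + 1)` and `(a - 1, b + 1)`. -/
def brick (s e : ℕ) (i : Fin t × Fin t) : Set (Fin s × Fin s) :=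
  {p | 4 * (e * i.1) + 4 * e + 2 * (e * i.2) ≤ (p.1 : ℕ) ∧
    (p.1 : ℕ) < 4 * (e * i.1) + 8 * e + 2 * (e * i.2) ∧
    4 * (e * i.2) + 4 * e ≤ (p.2 : ℕ) ∧ (p.2 : ℕ) < 4 * (e * i.2) + 8 * e}

/-- The territory of a vertex of `Γ_t` is its brick, except that the corner `(t-1, t-1)` gets all
that lies outside the other bricks. -/
def territory (s e : ℕ) (i : Fin t × Fin t) : Set (Fin s × Fin s) :=
  {p | IsCorner i ∧ (∀ j : Fin t × Fin t, ¬ IsCorner j → p ∉ brick s e j) ∨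
    ¬ IsCorner i ∧ p ∈ brick s e i}

/-- The core of a vertex of `Γ_t`: its territory, with a margin of width `m` removed from the
bricks. -/
def brickCore (s e m : ℕ) (i : Fin t × Fin t) : Set (Fin s × Fin s) :=
  {p | IsCorner i ∧ (∀ j : Fin t × Fin t, ¬ IsCorner j → p ∉ brick s e j) ∨
    ¬ IsCorner i ∧ 4 * (e * i.1) + 4 * e + 2 * (e * i.2) + m ≤ (p.1 : ℕ) ∧
    (p.1 : ℕ) + m < 4 * (e * i.1) + 8 * e + 2 * (e * i.2) ∧
    4 * (e * i.2) + 4 * e + m ≤ (p.2 : ℕ) ∧ (p.2 : ℕ) + m < 4 * (e * i.2) + 8 * e}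

lemma mul_add_le_mul_of_lt {a b : ℕ} (e : ℕ) (h : a < b) : e * a + e ≤ e * b := by
  rw [← Nat.mul_succ]
  exact Nat.mul_le_mul_left e h

lemma mul_add_two_mul_le_mul {a b : ℕ} (e : ℕ) (h : a + 2 ≤ b) : e * a + 2 * e ≤ e * b := by
  have := Nat.mul_le_mul_left e h
  rw [Nat.mul_add] at this
  omega

lemma exists_four_mul_le_lt (he : 0 < e) (z : ℕ) :
    ∃ a, 4 * (e * a) ≤ z ∧ z < 4 * (e * a) + 4 * e := by
  refine ⟨z / (4 * e), ?_, ?_⟩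
  · have := Nat.mul_div_le z (4 * e)
    rwa [Nat.mul_assoc] at this
  · have := Nat.lt_mul_div_succ z (show 0 < 4 * e by omega)
    rwa [Nat.mul_succ, Nat.mul_assoc] at this

lemma eq_of_four_mul_le_lt {a b z : ℕ} (ha : 4 * (e * a) ≤ z) (ha' : z < 4 * (e * a) + 4 * e)
    (hb : 4 * (e * b) ≤ z) (hb' : z < 4 * (e * b) + 4 * e) : a = b := by
  rcases lt_trichotomy a b with h | h | h
  · have := mul_add_le_mul_of_lt e h
    omega
  · exact h
  · have := mul_add_le_mul_of_lt e h
    omega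

lemma brick_row_eq {i : Fin t × Fin t} {p : Fin s × Fin s} (hp : p ∈ brick s e i) {b : ℕ}
    (h : 4 * (e * b) + 4 * e ≤ (p.2 : ℕ)) (h' : (p.2 : ℕ) < 4 * (e * b) + 8 * e) :
    (i.2 : ℕ) = b := by
  obtain ⟨-, -, h1, h2⟩ := hp
  exact eq_of_four_mul_le_lt (z := p.2 - 4 * e) (e := e) (by omega) (by omega) (by omega) (by omega)

lemma eq_of_mem_brick {i j : Fin t × Fin t} {p : Fin s × Fin s} (hi : p ∈ brick s e i)
    (hj : p ∈ brick s e j) : i = j := by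
  have hb : (i.2 : ℕ) = j.2 := brick_row_eq hi hj.2.2.1 hj.2.2.2
  obtain ⟨h1, h2, -, -⟩ := hi
  obtain ⟨h3, h4, -, -⟩ := hj
  rw [hb] at h1 h2
  refine Prod.ext (Fin.ext ?_) (Fin.ext hb)
  exact eq_of_four_mul_le_lt (z := p.1 - 4 * e - 2 * (e * j.2)) (e := e) (by omega) (by omega)
    (by omega) (by omega)

lemma IsCorner.eq {i j : Fin t × Fin t} (hi : IsCorner i) (hj : IsCorner j) : i = j := by
  obtain ⟨h1, h2⟩ := hi
  obtain ⟨h3, h4⟩ := hj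
  exact Prod.ext (Fin.ext (by omega)) (Fin.ext (by omega))

lemma eq_of_mem_territory {i j : Fin t × Fin t} {p : Fin s × Fin s} (hi : p ∈ territory s e i)
    (hj : p ∈ territory s e j) : i = j := by
  rcases hi with ⟨hi, hi'⟩ | ⟨hi, hi'⟩ <;> rcases hj with ⟨hj, hj'⟩ | ⟨hj, hj'⟩
  · exact hi.eq hj
  · exact (hi' j hj hj').elim
  · exact (hj' i hi hi').elim
  · exact eq_of_mem_brick hi' hj'

lemma brickCore_subset_territory (i : Fin t × Fin t) : brickCore s e m i ⊆ territory s e i := by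
  rintro p (h | ⟨hi, h⟩)
  · exact Or.inl h
  · refine Or.inr ⟨hi, ?_⟩
    simp only [brick, Set.mem_ofPred_eq]
    omega

/-- Below, above, to the left and to the right of the brick wall, the territory is that of the
corner. -/
lemma mem_territory_of_outside {i : Fin t × Fin t} (hi : IsCorner i) {p : Fin s × Fin s}
    (h : (p.2 : ℕ) < 4 * e ∨ 4 * (e * t) + 4 * e ≤ (p.2 : ℕ) ∨
      ∃ b, 4 * (e * b) + 4 * e ≤ (p.2 : ℕ) ∧ (p.2 : ℕ) < 4 * (e * b) + 8 * e ∧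
        ((p.1 : ℕ) < 4 * e + 2 * (e * b) ∨ 4 * (e * t) + 4 * e + 2 * (e * b) ≤ (p.1 : ℕ))) :
    p ∈ territory s e i := by
  refine Or.inl ⟨hi, fun j _ hp => ?_⟩
  have hj1 := mul_add_le_mul_of_lt e j.1.2
  have hj2 := mul_add_le_mul_of_lt e j.2.2
  rcases h with h | h | ⟨b, hb, hb', h⟩
  · have := hp.2.2.1
    omega
  · have := hp.2.2.2
    omega
  · have := brick_row_eq hp hb hb'
    subst this
    obtain ⟨h1, h2, -, -⟩ := hp
    omega

lemma IsCorner.mem_brickCore_iff {i : Fin t × Fin t} (hi : IsCorner i) {p : Fin s × Fin s} :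
    p ∈ brickCore s e m i ↔ p ∈ territory s e i := by
  simp [brickCore, territory, hi]

lemma exists_isCorner (ht : 0 < t) : ∃ i : Fin t × Fin t, IsCorner i :=
  ⟨(⟨t - 1, by omega⟩, ⟨t - 1, by omega⟩), by simp only [IsCorner]; omega⟩

lemma near_brickCore_mem_brick {i : Fin t × Fin t} (hi : ¬ IsCorner i) {p q : Fin s × Fin s}
    (hp : p ∈ brickCore s e m i) (hpq : Near m p q) : q ∈ brick s e i := by
  rcases hp with hp | ⟨-, hp⟩
  · exact (hi hp.1).elim
  · simp only [brick, Set.mem_ofPred_eq]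
    unfold Near at hpq
    omega

lemma brickCore_separated {i j : Fin t × Fin t} (hij : i ≠ j) {p q : Fin s × Fin s}
    (hp : p ∈ brickCore s e m i) (hq : q ∈ brickCore s e m j) : ¬ Near m p q := by
  intro h
  by_cases hi : IsCorner i
  · by_cases hj : IsCorner j
    · exact hij (hi.eq hj)
    · exact hij (eq_of_mem_territory (brickCore_subset_territory i hp)
        (Or.inr ⟨hj, near_brickCore_mem_brick hj hq h.symm⟩))
  · exact hij (eq_of_mem_territory (Or.inr ⟨hi, near_brickCore_mem_brick hi hp h⟩)
      (brickCore_subset_territory j hq))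

lemma rect_eq_brickCore {i : Fin t × Fin t} (hi : ¬ IsCorner i) (hm : m < e) :
    brickCore s e m i = rect s (4 * (e * i.1) + 4 * e + 2 * (e * i.2) + m)
      (4 * (e * i.1) + 8 * e + 2 * (e * i.2) - m - 1) (4 * (e * i.2) + 4 * e + m)
      (4 * (e * i.2) + 8 * e - m - 1) := by
  ext p
  simp only [brickCore, rect, hi, Set.mem_ofPred_eq, false_and, false_or, not_false_eq_true,
    true_and]
  omega

lemma frame_subset_brickCore (he : 0 < e) (hs : s = 10 * (e * t)) {i : Fin t × Fin t}
    (hi : IsCorner i) : frame s ⊆ brickCore s e m i := by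
  intro p hp
  refine Or.inl ⟨hi, fun j _ ⟨h1, h2, h3, h4⟩ => ?_⟩
  have hj1 := mul_add_le_mul_of_lt e j.1.2
  have hj2 := mul_add_le_mul_of_lt e j.2.2
  rcases hp with h | h | h | h <;> omega

lemma brickCore_connected (hm : m < e) (hs : s = 10 * (e * t)) (i : Fin t × Fin t) :
    ((triangulatedGrid s).induce (brickCore s e m i)).Connected := by
  have hi1 := mul_add_le_mul_of_lt e i.1.2
  have hi2 := mul_add_le_mul_of_lt e i.2.2
  have he : 0 < e := by omega
  by_cases hi : IsCorner i
  · -- Every point of the core is joined to the boundary by a horizontal segment in the core.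
    have hs0 : s - 1 < s := by omega
    have hcf : ((⟨s - 1, hs0⟩, ⟨s - 1, hs0⟩) : Fin s × Fin s) ∈ frame s := by
      simp only [frame, Set.mem_ofPred_eq]
      omega
    refine induce_connected_of_induction (frame_subset_brickCore he hs hi hcf) ?_
    intro P hP hstep p hp
    have hframe : ∀ q ∈ frame s, P q := by
      intro q hq
      by_cases hqc : q = (⟨s - 1, hs0⟩, ⟨s - 1, hs0⟩)
      · rwa [hqc]
      · refine hstep _ q (frame_subset_brickCore he hs hi hcf) (frame_subset_brickCore he hs hi hq)
          ?_ hP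
        simp only [triangulatedGrid, fromRel_adj]
        refine ⟨fun h => hqc h.symm, Or.inl (Or.inr (Or.inr ⟨?_, hq⟩))⟩
        omega
    have hleft : (∀ o : Fin s × Fin s, o.2 = p.2 → (o.1 : ℕ) ≤ p.1 → o ∈ brickCore s e m i) →
        P p := fun h => (iff_of_horizontal_segment hstep (p := (⟨0, by omega⟩, p.2)) (q := p) rfl
          (Nat.zero_le _) (fun o h1 _ h3 => h o h1 h3)).1 (hframe _ (Or.inl rfl))
    have hright : (∀ o : Fin s × Fin s, o.2 = p.2 → (p.1 : ℕ) ≤ o.1 → o ∈ brickCore s e m i) →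
        P p := fun h => (iff_of_horizontal_segment hstep (p := p) (q := (⟨s - 1, hs0⟩, p.2)) rfl
          (by simp only; omega) (fun o h1 h2 _ => h o h1 h2)).2
          (hframe _ (Or.inr (Or.inl (by simp only; omega))))
    simp only [hi.mem_brickCore_iff] at hleft hright hp
    by_cases hy : (p.2 : ℕ) < 4 * e ∨ 4 * (e * t) + 4 * e ≤ (p.2 : ℕ)
    · refine hleft fun o ho _ => mem_territory_of_outside hi ?_
      rw [ho]
      tauto
    obtain ⟨b, hb, hb'⟩ := exists_four_mul_le_lt he ((p.2 : ℕ) - 4 * e)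
    have hbt : b < t := by
      by_contra h
      have := Nat.mul_le_mul_left e (Nat.le_of_not_lt h)
      omega
    by_cases hx : (p.1 : ℕ) < 4 * e + 2 * (e * b)
    · refine hleft fun o ho ho' => mem_territory_of_outside hi (Or.inr (Or.inr ⟨b, ?_⟩))
      rw [ho]
      omega
    obtain ⟨a, ha, ha'⟩ := exists_four_mul_le_lt he ((p.1 : ℕ) - 4 * e - 2 * (e * b))
    by_cases hat : a < t
    · -- Only the brick of the corner itself is possible here.
      have hcor : IsCorner ((⟨a, hat⟩, ⟨b, hbt⟩) : Fin t × Fin t) := by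
        rcases hp with ⟨-, hp⟩ | ⟨h, -⟩
        · by_contra h
          refine hp _ h ?_
          simp only [brick, Set.mem_ofPred_eq]
          omega
        · exact (h hi).elim
      obtain ⟨hat', hbt'⟩ := hcor
      simp only at hat' hbt'
      refine hright fun o ho ho' => Or.inl ⟨hi, fun j hj hoj => hj ?_⟩
      have hjb : (j.2 : ℕ) = b := brick_row_eq hoj (b := b) (by rw [ho]; omega) (by rw [ho]; omega)
      refine ⟨?_, by omega⟩
      by_contra hne
      have hja : (j.1 : ℕ) < a := by omega
      have := mul_add_le_mul_of_lt e hja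
      obtain ⟨h1, h2, -, -⟩ := hoj
      rw [hjb] at h2
      omega
    · refine hright fun o ho ho' => mem_territory_of_outside hi (Or.inr (Or.inr ⟨b, ?_⟩))
      have := Nat.mul_le_mul_left e (Nat.le_of_not_lt hat)
      rw [ho]
      omega
  · rw [rect_eq_brickCore hi hm]
    exact rect_connected (by omega) (by omega) (by omega) (by omega)

/-- Moving a number by at most `m` into the interval that remains of `[lo, lo + 4 * e)` after
removing margins of width `m`. -/
lemma exists_clamp (hm : m < e) {lo z : ℕ} (h : lo ≤ z) (h' : z < lo + 4 * e) :
    ∃ x, lo + m ≤ x ∧ x + m < lo + 4 * e ∧ x ≤ z + m ∧ z ≤ x + m := by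
  rcases lt_or_ge z (lo + m) with h1 | h1
  · exact ⟨lo + m, by omega⟩
  rcases lt_or_ge (z + m) (lo + 4 * e) with h2 | h2
  · exact ⟨z, by omega⟩
  · exact ⟨lo + 4 * e - m - 1, by omega⟩

lemma brickCore_reach (hm : m < e) (ht : 0 < t) (hs : s = 10 * (e * t)) (p : Fin s × Fin s) :
    ∃ X : Set (Fin s × Fin s), p ∈ X ∧ ((triangulatedGrid s).induce X).Connected ∧
      (∀ q ∈ X, Near m p q) ∧ ∃ i : Fin t × Fin t, ∃ q ∈ brickCore s e m i, q ∈ X := by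
  by_cases h : ∃ i : Fin t × Fin t, ¬ IsCorner i ∧ p ∈ brick s e i
  · obtain ⟨i, hi, h1, h2, h3, h4⟩ := h
    have hi1 := mul_add_le_mul_of_lt e i.1.2
    have hi2 := mul_add_le_mul_of_lt e i.2.2
    obtain ⟨x, hx1, hx2, hx3, hx4⟩ := exists_clamp hm h1 (by omega)
    obtain ⟨y, hy1, hy2, hy3, hy4⟩ := exists_clamp hm h3 (by omega)
    have hxs : x < s := by omega
    have hys : y < s := by omega
    refine ⟨rect s (min p.1 x) (max p.1 x) (min p.2 y) (max p.2 y), ?_, ?_, ?_, i,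
      (⟨x, hxs⟩, ⟨y, hys⟩), Or.inr ⟨hi, ?_⟩, ?_⟩
    · simp only [rect, Set.mem_ofPred_eq]
      omega
    · exact rect_connected (by omega) (by omega) (by omega) (by omega)
    · rintro q ⟨h5, h6, h7, h8⟩
      unfold Near
      omega
    · simp only
      omega
    · simp only [rect, Set.mem_ofPred_eq]
      omega
  · obtain ⟨i, hi⟩ := exists_isCorner ht
    push Not at h
    exact ⟨{p}, rfl, induce_singleton_connected p,
      fun q hq => by rw [Set.mem_singleton_iff.1 hq]; exact near_refl m p,
      i, p, Or.inl ⟨hi, fun j hj => h j hj⟩, rfl⟩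

/-- The territory of the corner is far from the bricks of the vertices not adjacent to it, which are
the inner vertices: an inner brick is surrounded by other bricks. -/
lemma not_near_of_not_isCorner_of_isCorner {i j : Fin t × Fin t} (hi : ¬ IsCorner i)
    (hj : IsCorner j) (hij : ¬ (triangulatedGrid t).Adj i j) {p q : Fin s × Fin s}
    (hp : p ∈ brick s e i) (hq : q ∈ territory s e j) {R : ℕ} (hR : R < e) :
    ¬ Near (2 * R) p q := by
  intro hpq
  have hne : j ≠ i := fun h => hi (h ▸ hj)
  simp only [triangulatedGrid, fromRel_adj, abs_eq_max_neg] at hij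
  obtain ⟨hj1, hj2⟩ := hj
  have ha0 : 0 < (i.1 : ℕ) := by
    by_contra h
    exact hij ⟨hne.symm, Or.inr (Or.inr (Or.inr ⟨⟨hj1, hj2⟩, by omega⟩))⟩
  have ha1 : (i.1 : ℕ) + 1 < t := by
    by_contra h
    exact hij ⟨hne.symm, Or.inr (Or.inr (Or.inr ⟨⟨hj1, hj2⟩, by omega⟩))⟩
  have hb0 : 0 < (i.2 : ℕ) := by
    by_contra h
    exact hij ⟨hne.symm, Or.inr (Or.inr (Or.inr ⟨⟨hj1, hj2⟩, by omega⟩))⟩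
  have hb1 : (i.2 : ℕ) + 1 < t := by
    by_contra h
    exact hij ⟨hne.symm, Or.inr (Or.inr (Or.inr ⟨⟨hj1, hj2⟩, by omega⟩))⟩
  rcases hq with ⟨-, hq⟩ | ⟨h, -⟩
  swap
  · exact h ⟨hj1, hj2⟩
  obtain ⟨a, ha⟩ : ∃ a, (i.1 : ℕ) = a + 1 := ⟨i.1 - 1, by omega⟩
  obtain ⟨b, hb⟩ : ∃ b, (i.2 : ℕ) = b + 1 := ⟨i.2 - 1, by omega⟩
  have hno : ∀ a' b' : ℕ, a' < t → b' < t → ¬ (a' + 1 = t ∧ b' + 1 = t) →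
      ¬ (4 * (e * a') + 4 * e + 2 * (e * b') ≤ (q.1 : ℕ) ∧
    (q.1 : ℕ) < 4 * (e * a') + 8 * e + 2 * (e * b') ∧
    4 * (e * b') + 4 * e ≤ (q.2 : ℕ) ∧ (q.2 : ℕ) < 4 * (e * b') + 8 * e) :=
    fun a' b' h1 h2 h3 h4 => hq (⟨a', h1⟩, ⟨b', h2⟩) h3 h4
  obtain ⟨p1, p2, p3, p4⟩ := hp
  obtain ⟨n1, n2, n3, n4⟩ := hpq
  have e1 : ∀ c, e * (c + 1) = e * c + e := fun c => Nat.mul_succ e c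
  rw [ha, hb, e1, e1] at p1 p2
  rw [hb, e1] at p3 p4
  -- The rows `b`, `b + 1`, `b + 2` and the bricks near `p` in each of them.
  have q1 := hno a b (by omega) (by omega) (by omega)
  have q2 := hno (a + 1) b (by omega) (by omega) (by omega)
  have q3 := hno (a + 2) b (by omega) (by omega) (by omega)
  have q4 := hno a (b + 1) (by omega) (by omega) (by omega)
  have q5 := hno (a + 1) (b + 1) (by omega) (by omega) (by omega)
  have q6 := hno (a + 2) (b + 1) (by omega) (by omega) (by omega)
  have q7 := hno a (b + 2) (by omega) (by omega) (by omega)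
  have q8 := hno (a + 1) (b + 2) (by omega) (by omega) (by omega)
  simp only [e1] at q1 q2 q3 q4 q5 q6 q7 q8
  rcases lt_or_ge (q.2 : ℕ) (4 * (e * b) + 8 * e) with h | h
  · clear q4 q5 q6 q7 q8
    omega
  rcases lt_or_ge (q.2 : ℕ) (4 * (e * b) + 12 * e) with h' | h'
  · clear q1 q2 q3 q7 q8
    omega
  · clear q1 q2 q3 q4 q5 q6
    omega

lemma brickCore_far {R : ℕ} (hR : R < e) {i j : Fin t × Fin t} (hij : i ≠ j)
    (hadj : ¬ (triangulatedGrid t).Adj i j) {p q : Fin s × Fin s} (hp : p ∈ brickCore s e m i)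
    (hq : q ∈ brickCore s e m j) : ¬ Near (2 * R) p q := by
  rcases brickCore_subset_territory i hp with ⟨hi, hp'⟩ | ⟨hi, hp'⟩
  · rcases brickCore_subset_territory j hq with ⟨hj, hq'⟩ | ⟨hj, hq'⟩
    · exact (hij (hi.eq hj)).elim
    · exact fun h => not_near_of_not_isCorner_of_isCorner hj hi (fun h => hadj h.symm) hq'
        (brickCore_subset_territory i hp) hR h.symm
  rcases brickCore_subset_territory j hq with ⟨hj, hq'⟩ | ⟨hj, hq'⟩
  · exact not_near_of_not_isCorner_of_isCorner hi hj hadj hp'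
      (brickCore_subset_territory j hq) hR
  clear hp hq
  wlog hle : (i.2 : ℕ) ≤ j.2 generalizing i j p q
  · exact fun h => this hij.symm (fun h => hadj h.symm) hj hq' hi hp' (by omega) h.symm
  rintro ⟨n1, n2, n3, n4⟩
  obtain ⟨p1, p2, p3, p4⟩ := hp'
  obtain ⟨q1, q2, q3, q4⟩ := hq'
  simp only [triangulatedGrid, fromRel_adj, abs_eq_max_neg, ne_eq, Prod.ext_iff,
    Fin.ext_iff] at hadj hij
  rcases lt_or_ge ((i.2 : ℕ) + 1) j.2 with hb | hb
  · have := mul_add_two_mul_le_mul e (show (i.2 : ℕ) + 2 ≤ j.2 by omega)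
    omega
  rcases Nat.lt_or_ge (i.2 : ℕ) j.2 with hb' | hb'
  · have hb2 : (j.2 : ℕ) = i.2 + 1 := by omega
    rw [hb2, Nat.mul_succ] at q1 q2
    rcases lt_or_ge (i.1 : ℕ) j.1 with ha | ha
    · have := mul_add_le_mul_of_lt e ha
      omega
    · have := mul_add_two_mul_le_mul e (show (j.1 : ℕ) + 2 ≤ i.1 by omega)
      omega
  · have hb2 : (j.2 : ℕ) = i.2 := by omega
    rw [hb2] at q1 q2
    rcases lt_or_ge (i.1 : ℕ) j.1 with ha | ha
    · have := mul_add_two_mul_le_mul e (show (i.1 : ℕ) + 2 ≤ j.1 by omega)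
      omega
    · have := mul_add_two_mul_le_mul e (show (j.1 : ℕ) + 2 ≤ i.1 by omega)
      omega

/-- Two vertices of `Γ_t` are linked if a connected set of grid points meets both of their cores and
has its `R`-neighbourhood in the union of their territories. -/
def IsLinked (s e m R : ℕ) (i j : Fin t × Fin t) : Prop :=
  ∃ X : Set (Fin s × Fin s), ((triangulatedGrid s).induce X).Connected ∧
    (∃ q ∈ brickCore s e m i, q ∈ X) ∧ (∃ q ∈ brickCore s e m j, q ∈ X) ∧
    ∀ p ∈ X, ∀ q, Near R p q → q ∈ territory s e i ∨ q ∈ territory s e j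

lemma IsLinked.symm {R : ℕ} {i j : Fin t × Fin t} (h : IsLinked s e m R i j) :
    IsLinked s e m R j i := by
  obtain ⟨X, h1, h2, h3, h4⟩ := h
  exact ⟨X, h1, h3, h2, fun p hp q hpq => (h4 p hp q hpq).symm⟩

lemma isLinked_of_rect {R : ℕ} {i j : Fin t × Fin t} {x₀ x₁ y₀ y₁ x y x' y' : ℕ}
    (hx₁ : x₁ < s) (hy₁ : y₁ < s) (hx : x₀ ≤ x ∧ x ≤ x₁) (hy : y₀ ≤ y ∧ y ≤ y₁)
    (hx' : x₀ ≤ x' ∧ x' ≤ x₁) (hy' : y₀ ≤ y' ∧ y' ≤ y₁)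
    (hi : ∀ p : Fin s × Fin s, (p.1 : ℕ) = x → (p.2 : ℕ) = y → p ∈ brickCore s e m i)
    (hj : ∀ p : Fin s × Fin s, (p.1 : ℕ) = x' → (p.2 : ℕ) = y' → p ∈ brickCore s e m j)
    (h : ∀ q : Fin s × Fin s, x₀ ≤ (q.1 : ℕ) + R → (q.1 : ℕ) ≤ x₁ + R → y₀ ≤ (q.2 : ℕ) + R →
      (q.2 : ℕ) ≤ y₁ + R → q ∈ territory s e i ∨ q ∈ territory s e j) :
    IsLinked s e m R i j := by
  refine ⟨rect s x₀ x₁ y₀ y₁, rect_connected (by omega) (by omega) hx₁ hy₁,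
    ⟨(⟨x, by omega⟩, ⟨y, by omega⟩), hi _ rfl rfl, hx.1, hx.2, hy.1, hy.2⟩,
    ⟨(⟨x', by omega⟩, ⟨y', by omega⟩), hj _ rfl rfl, hx'.1, hx'.2, hy'.1, hy'.2⟩, ?_⟩
  rintro p ⟨h1, h2, h3, h4⟩ q ⟨n1, n2, n3, n4⟩
  exact h q (by omega) (by omega) (by omega) (by omega)

end Bricks

/-! ### Links between adjacent bricks -/

section BrickLinks

variable {s t e m R : ℕ}

lemma mem_brickCore_of_not_isCorner {i : Fin t × Fin t} (hi : ¬ IsCorner i) {p : Fin s × Fin s}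
    (h : 4 * (e * i.1) + 4 * e + 2 * (e * i.2) + m ≤ (p.1 : ℕ) ∧
    (p.1 : ℕ) + m < 4 * (e * i.1) + 8 * e + 2 * (e * i.2) ∧
    4 * (e * i.2) + 4 * e + m ≤ (p.2 : ℕ) ∧ (p.2 : ℕ) + m < 4 * (e * i.2) + 8 * e) :
    p ∈ brickCore s e m i := Or.inr ⟨hi, h⟩

lemma mem_territory_of_not_isCorner {i : Fin t × Fin t} (hi : ¬ IsCorner i) {p : Fin s × Fin s}
    (h : 4 * (e * i.1) + 4 * e + 2 * (e * i.2) ≤ (p.1 : ℕ) ∧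
    (p.1 : ℕ) < 4 * (e * i.1) + 8 * e + 2 * (e * i.2) ∧
    4 * (e * i.2) + 4 * e ≤ (p.2 : ℕ) ∧ (p.2 : ℕ) < 4 * (e * i.2) + 8 * e) :
    p ∈ territory s e i := Or.inr ⟨hi, h⟩

lemma isLinked_right (hm : m < e) (hR : R < e) (hs : s = 10 * (e * t)) {i j : Fin t × Fin t}
    (hi : ¬ IsCorner i) (hj : ¬ IsCorner j) (h1 : (j.1 : ℕ) = i.1 + 1) (h2 : (j.2 : ℕ) = i.2) :
    IsLinked s e m R i j := by
  have hj1 := mul_add_le_mul_of_lt e j.1.2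
  have hj2 := mul_add_le_mul_of_lt e j.2.2
  have e1 : e * (j.1 : ℕ) = e * i.1 + e := by rw [h1, Nat.mul_succ]
  have e2 : e * (j.2 : ℕ) = e * i.2 := by rw [h2]
  refine isLinked_of_rect (x₀ := 4 * (e * i.1) + 6 * e + 2 * (e * i.2))
    (x₁ := 4 * (e * i.1) + 10 * e + 2 * (e * i.2)) (y₀ := 4 * (e * i.2) + 6 * e)
    (y₁ := 4 * (e * i.2) + 6 * e) (x := 4 * (e * i.1) + 6 * e + 2 * (e * i.2))
    (y := 4 * (e * i.2) + 6 * e) (x' := 4 * (e * i.1) + 10 * e + 2 * (e * i.2))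
    (y' := 4 * (e * i.2) + 6 * e) (by omega) (by omega) (by omega) (by omega) (by omega)
    (by omega) (fun p hx hy => mem_brickCore_of_not_isCorner hi (by omega))
    (fun p hx hy => mem_brickCore_of_not_isCorner hj (by omega)) (fun q n1 n2 n3 n4 => ?_)
  rcases lt_or_ge (q.1 : ℕ) (4 * (e * i.1) + 8 * e + 2 * (e * i.2)) with h | h
  · exact Or.inl (mem_territory_of_not_isCorner hi (by omega))
  · exact Or.inr (mem_territory_of_not_isCorner hj (by omega))

lemma isLinked_up (hm : m < e) (hR : R < e) (hs : s = 10 * (e * t)) {i j : Fin t × Fin t}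
    (hi : ¬ IsCorner i) (hj : ¬ IsCorner j) (h1 : (j.1 : ℕ) = i.1) (h2 : (j.2 : ℕ) = i.2 + 1) :
    IsLinked s e m R i j := by
  have hj1 := mul_add_le_mul_of_lt e j.1.2
  have hj2 := mul_add_le_mul_of_lt e j.2.2
  have e1 : e * (j.1 : ℕ) = e * i.1 := by rw [h1]
  have e2 : e * (j.2 : ℕ) = e * i.2 + e := by rw [h2, Nat.mul_succ]
  refine isLinked_of_rect (x₀ := 4 * (e * i.1) + 7 * e + 2 * (e * i.2))
    (x₁ := 4 * (e * i.1) + 7 * e + 2 * (e * i.2)) (y₀ := 4 * (e * i.2) + 6 * e)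
    (y₁ := 4 * (e * i.2) + 10 * e) (x := 4 * (e * i.1) + 7 * e + 2 * (e * i.2))
    (y := 4 * (e * i.2) + 6 * e) (x' := 4 * (e * i.1) + 7 * e + 2 * (e * i.2))
    (y' := 4 * (e * i.2) + 10 * e) (by omega) (by omega) (by omega) (by omega) (by omega)
    (by omega) (fun p hx hy => mem_brickCore_of_not_isCorner hi (by omega))
    (fun p hx hy => mem_brickCore_of_not_isCorner hj (by omega)) (fun q n1 n2 n3 n4 => ?_)
  rcases lt_or_ge (q.2 : ℕ) (4 * (e * i.2) + 8 * e) with h | h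
  · exact Or.inl (mem_territory_of_not_isCorner hi (by omega))
  · exact Or.inr (mem_territory_of_not_isCorner hj (by omega))

lemma isLinked_diagonal (hm : m < e) (hR : R < e) (hs : s = 10 * (e * t)) {i j : Fin t × Fin t}
    (h1 : (i.1 : ℕ) = j.1 + 1) (h2 : (j.2 : ℕ) = i.2 + 1) :
    IsLinked s e m R i j := by
  have hj2 := mul_add_le_mul_of_lt e j.2.2
  have hi1 := mul_add_le_mul_of_lt e i.1.2
  have e1 : e * (i.1 : ℕ) = e * j.1 + e := by rw [h1, Nat.mul_succ]
  have e2 : e * (j.2 : ℕ) = e * i.2 + e := by rw [h2, Nat.mul_succ]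
  have hi : ¬ IsCorner i := fun h => by have := h.2; omega
  have hj : ¬ IsCorner j := fun h => by have := h.1; omega
  refine isLinked_of_rect (x₀ := 4 * (e * i.1) + 5 * e + 2 * (e * i.2))
    (x₁ := 4 * (e * i.1) + 5 * e + 2 * (e * i.2)) (y₀ := 4 * (e * i.2) + 6 * e)
    (y₁ := 4 * (e * i.2) + 10 * e) (x := 4 * (e * i.1) + 5 * e + 2 * (e * i.2))
    (y := 4 * (e * i.2) + 6 * e) (x' := 4 * (e * i.1) + 5 * e + 2 * (e * i.2))
    (y' := 4 * (e * i.2) + 10 * e) (by omega) (by omega) (by omega) (by omega) (by omega)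
    (by omega) (fun p hx hy => mem_brickCore_of_not_isCorner hi (by omega))
    (fun p hx hy => mem_brickCore_of_not_isCorner hj (by omega)) (fun q n1 n2 n3 n4 => ?_)
  rcases lt_or_ge (q.2 : ℕ) (4 * (e * i.2) + 8 * e) with h | h
  · exact Or.inl (mem_territory_of_not_isCorner hi (by omega))
  · exact Or.inr (mem_territory_of_not_isCorner hj (by omega))

/-- A brick on the border of the wall is linked to the territory of the corner by a segment leaving
the wall on that side. -/
lemma isLinked_corner (hm : m < e) (hR : R < e) (hs : s = 10 * (e * t)) {i j : Fin t × Fin t}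
    (hi : ¬ IsCorner i) (hj : IsCorner j)
    (h : (i.1 : ℕ) = 0 ∨ (i.1 : ℕ) + 1 = t ∨ (i.2 : ℕ) = 0 ∨ (i.2 : ℕ) + 1 = t) :
    IsLinked s e m R i j := by
  have hi1 := mul_add_le_mul_of_lt e i.1.2
  have hi2 := mul_add_le_mul_of_lt e i.2.2
  rcases h with h | h | h | h
  · have e1 : e * (i.1 : ℕ) = 0 := by rw [h, Nat.mul_zero]
    refine isLinked_of_rect (x₀ := 2 * e + 2 * (e * i.2)) (x₁ := 6 * e + 2 * (e * i.2))
      (y₀ := 4 * (e * i.2) + 6 * e) (y₁ := 4 * (e * i.2) + 6 * e) (x := 6 * e + 2 * (e * i.2))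
      (y := 4 * (e * i.2) + 6 * e) (x' := 2 * e + 2 * (e * i.2)) (y' := 4 * (e * i.2) + 6 * e)
      (by omega) (by omega) (by omega) (by omega) (by omega) (by omega)
      (fun p hx hy => mem_brickCore_of_not_isCorner hi (by omega))
      (fun p hx hy => hj.mem_brickCore_iff.2 (mem_territory_of_outside hj
        (Or.inr (Or.inr ⟨i.2, by omega⟩)))) (fun q n1 n2 n3 n4 => ?_)
    rcases lt_or_ge (q.1 : ℕ) (4 * e + 2 * (e * i.2)) with h' | h'
    · exact Or.inr (mem_territory_of_outside hj (Or.inr (Or.inr ⟨i.2, by omega⟩)))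
    · exact Or.inl (mem_territory_of_not_isCorner hi (by omega))
  · have e1 : e * t = e * (i.1 : ℕ) + e := by rw [← Nat.mul_succ, Nat.succ_eq_add_one, h]
    have hi3 := mul_add_two_mul_le_mul e (show (i.2 : ℕ) + 2 ≤ t by
      have := i.2.2
      have : (i.2 : ℕ) + 1 ≠ t := fun h' => hi ⟨h, h'⟩
      omega)
    refine isLinked_of_rect (x₀ := 4 * (e * i.1) + 6 * e + 2 * (e * i.2))
      (x₁ := 4 * (e * i.1) + 10 * e + 2 * (e * i.2)) (y₀ := 4 * (e * i.2) + 6 * e)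
      (y₁ := 4 * (e * i.2) + 6 * e) (x := 4 * (e * i.1) + 6 * e + 2 * (e * i.2))
      (y := 4 * (e * i.2) + 6 * e) (x' := 4 * (e * i.1) + 10 * e + 2 * (e * i.2))
      (y' := 4 * (e * i.2) + 6 * e)
      (by omega) (by omega) (by omega) (by omega) (by omega) (by omega)
      (fun p hx hy => mem_brickCore_of_not_isCorner hi (by omega))
      (fun p hx hy => hj.mem_brickCore_iff.2 (mem_territory_of_outside hj
        (Or.inr (Or.inr ⟨i.2, by omega⟩)))) (fun q n1 n2 n3 n4 => ?_)
    rcases lt_or_ge (q.1 : ℕ) (4 * (e * i.1) + 8 * e + 2 * (e * i.2)) with h' | h'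
    · exact Or.inl (mem_territory_of_not_isCorner hi (by omega))
    · exact Or.inr (mem_territory_of_outside hj (Or.inr (Or.inr ⟨i.2, by omega⟩)))
  · have e2 : e * (i.2 : ℕ) = 0 := by rw [h, Nat.mul_zero]
    refine isLinked_of_rect (x₀ := 4 * (e * i.1) + 6 * e) (x₁ := 4 * (e * i.1) + 6 * e)
      (y₀ := 2 * e) (y₁ := 6 * e) (x := 4 * (e * i.1) + 6 * e) (y := 6 * e)
      (x' := 4 * (e * i.1) + 6 * e) (y' := 2 * e)
      (by omega) (by omega) (by omega) (by omega) (by omega) (by omega)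
      (fun p hx hy => mem_brickCore_of_not_isCorner hi (by omega))
      (fun p hx hy => hj.mem_brickCore_iff.2 (mem_territory_of_outside hj (by omega)))
      (fun q n1 n2 n3 n4 => ?_)
    rcases lt_or_ge (q.2 : ℕ) (4 * e) with h' | h'
    · exact Or.inr (mem_territory_of_outside hj (Or.inl h'))
    · exact Or.inl (mem_territory_of_not_isCorner hi (by omega))
  · have e2 : e * t = e * (i.2 : ℕ) + e := by rw [← Nat.mul_succ, Nat.succ_eq_add_one, h]
    have hi3 := mul_add_two_mul_le_mul e (show (i.1 : ℕ) + 2 ≤ t by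
      have := i.1.2
      have : (i.1 : ℕ) + 1 ≠ t := fun h' => hi ⟨h', h⟩
      omega)
    refine isLinked_of_rect (x₀ := 4 * (e * i.1) + 6 * e + 2 * (e * i.2))
      (x₁ := 4 * (e * i.1) + 6 * e + 2 * (e * i.2)) (y₀ := 4 * (e * i.2) + 6 * e)
      (y₁ := 4 * (e * i.2) + 10 * e) (x := 4 * (e * i.1) + 6 * e + 2 * (e * i.2))
      (y := 4 * (e * i.2) + 6 * e) (x' := 4 * (e * i.1) + 6 * e + 2 * (e * i.2))
      (y' := 4 * (e * i.2) + 10 * e)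
      (by omega) (by omega) (by omega) (by omega) (by omega) (by omega)
      (fun p hx hy => mem_brickCore_of_not_isCorner hi (by omega))
      (fun p hx hy => hj.mem_brickCore_iff.2 (mem_territory_of_outside hj (by omega)))
      (fun q n1 n2 n3 n4 => ?_)
    rcases lt_or_ge (q.2 : ℕ) (4 * (e * i.2) + 8 * e) with h' | h'
    · exact Or.inl (mem_territory_of_not_isCorner hi (by omega))
    · exact Or.inr (mem_territory_of_outside hj (Or.inr (Or.inl (by omega))))

lemma isLinked_of_adj (hm : m < e) (hR : R < e) (hs : s = 10 * (e * t)) {i j : Fin t × Fin t}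
    (h : (triangulatedGrid t).Adj i j) : IsLinked s e m R i j := by
  have key : ∀ i j : Fin t × Fin t, i ≠ j →
      (|(i.1 : ℤ) - (j.1 : ℤ)| + |(i.2 : ℤ) - (j.2 : ℤ)| = 1 ∨
      ((i.1 : ℕ) = j.1 + 1 ∧ (j.2 : ℕ) = i.2 + 1) ∨
      (((i.1 : ℕ) + 1 = t ∧ (i.2 : ℕ) + 1 = t) ∧
      ((j.1 : ℕ) = 0 ∨ (j.1 : ℕ) + 1 = t ∨ (j.2 : ℕ) = 0 ∨ (j.2 : ℕ) + 1 = t))) →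
      IsLinked s e m R i j := by
    intro i j hne h
    rw [abs_eq_max_neg, abs_eq_max_neg] at h
    by_cases hi : IsCorner i
    · have hj : ¬ IsCorner j := fun hj => hne (hi.eq hj)
      have hi' := hi
      obtain ⟨h1, h2⟩ := hi'
      exact (isLinked_corner hm hR hs hj hi (by omega)).symm
    by_cases hj : IsCorner j
    · have hj' := hj
      obtain ⟨h1, h2⟩ := hj'
      exact isLinked_corner hm hR hs hi hj (by omega)
    rcases h with h | h | h
    · rcases lt_trichotomy (i.1 : ℕ) j.1 with h1 | h1 | h1
      · exact isLinked_right hm hR hs hi hj (by omega) (by omega)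
      · rcases lt_or_ge (i.2 : ℕ) j.2 with h2 | h2
        · exact isLinked_up hm hR hs hi hj (by omega) (by omega)
        · exact (isLinked_up hm hR hs hj hi (by omega) (by omega)).symm
      · exact (isLinked_right hm hR hs hj hi (by omega) (by omega)).symm
    · exact isLinked_diagonal hm hR hs h.1 h.2
    · exact (hi h.1).elim
  simp only [triangulatedGrid, fromRel_adj] at h
  rcases h with ⟨hne, h | h⟩
  · exact key i j hne h
  · exact (key j i hne.symm h).symm

/-- The brick wall is a coarse drawing of `Γ_t` in a triangulated grid of size linear in `t`. -/
theorem isCoarseDrawing_brickCore (hm : m < e) (hR : R < e) (ht : 0 < t)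
    (hs : s = 10 * (e * t)) :
    IsCoarseDrawing m R (fun i : Fin t × Fin t => brickCore s e m i) where
  connected := brickCore_connected hm hs
  separated _ _ hij _ hp _ hq := brickCore_separated hij hp hq
  frame_subset := by
    obtain ⟨i, hi⟩ := exists_isCorner ht
    exact ⟨i, frame_subset_brickCore (by omega) hs hi⟩
  reach := brickCore_reach hm ht hs
  far _ _ hij hadj _ hp _ hq := brickCore_far hR hij hadj hp hq
  link i j hij := by
    obtain ⟨X, h1, h2, h3, h4⟩ := isLinked_of_adj hm hR hs hij
    refine ⟨X, h1, h2, h3, fun k hki hkj p hp q hq hpq => ?_⟩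
    rcases h4 p hp q hpq with h | h
    · exact hki (eq_of_mem_territory (brickCore_subset_territory k hq) h)
    · exact hkj (eq_of_mem_territory (brickCore_subset_territory k hq) h)

end BrickLinks

/-! ### Sparse connected covers -/

section SparseCover

variable {V W : Type*} {S : SimpleGraph V} {H : SimpleGraph W} {mem : W → Set V} {d : ℕ}

/-- The vertices of `mem A` that lie in another member of the family as well. -/
def shared (mem : W → Set V) (A : W) : Set V := {x | x ∈ mem A ∧ ∃ B, B ≠ A ∧ x ∈ mem B}

/-- `H` is the intersection graph of the connected vertex sets `mem A`, which cover `S` sparsely: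
each has at most `d` shared vertices. Moreover `S` is edge-minimal with connected `mem A`: every
edge `uv` is the only edge across some cut `Y` of the graph induced by some `mem A`. -/
structure IsSparseCover (S : SimpleGraph V) (H : SimpleGraph W) (mem : W → Set V) (d : ℕ) :
    Prop where
  adj_iff : ∀ A B, H.Adj A B ↔ A ≠ B ∧ (mem A ∩ mem B).Nonempty
  connected : ∀ A, (S.induce (mem A)).Connected
  cover : ∀ x, ∃ A, x ∈ mem A
  cut : ∀ u v, S.Adj u v → ∃ A, u ∈ mem A ∧ v ∈ mem A ∧ ∃ Y : Set V, u ∈ Y ∧ v ∉ Y ∧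
    ∀ x ∈ mem A, ∀ y ∈ mem A, S.Adj x y → x ∈ Y → y ∉ Y → x = u ∧ y = v
  card_shared : ∀ A, (shared mem A).ncard ≤ d

/-- The members of the cover that touch a connected set form a connected set of the intersection
graph. -/
lemma IsSparseCover.touch_connected (hS : IsSparseCover S H mem d) {X : Set V}
    (hX : (S.induce X).Connected) : (H.induce {A | (mem A ∩ X).Nonempty}).Connected := by
  obtain ⟨x₀, hx₀⟩ := hX.induce_nonempty
  obtain ⟨A₀, hA₀⟩ := hS.cover x₀
  refine induce_connected_of_induction (r := A₀) ⟨x₀, hA₀, hx₀⟩ fun P hP hstep => ?_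
  have hmeet : ∀ A B x, x ∈ X → x ∈ mem A → x ∈ mem B → P A → P B := by
    intro A B x hx hA hB hPA
    by_cases hAB : A = B
    · exact hAB ▸ hPA
    · exact hstep A B ⟨x, hA, hx⟩ ⟨x, hB, hx⟩ ((hS.adj_iff A B).2 ⟨hAB, x, hA, hB⟩) hPA
  have key : ∀ x ∈ X, ∀ A, x ∈ mem A → P A := by
    intro x hx
    refine hX.induce_induction (P := fun x => ∀ A, x ∈ mem A → P A) hx₀
      (fun A hA => hmeet A₀ A x₀ hx₀ hA₀ hA hP) ?_ hx
    intro v w hv hw hvw ih A hA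
    obtain ⟨B, hvB, hwB, -⟩ := hS.cut v w hvw
    exact hmeet B A w hw hwB hA (ih B hvB)
  rintro A ⟨x, hxA, hx⟩
  exact key x hx A hxA

/-- The treewidth of a sparse intersection graph is bounded linearly by that of the base graph:
replace every vertex of a bag by the members of the cover containing it. -/
lemma treewidth_le_of_cover [Finite V]
    (hadj : ∀ A B, H.Adj A B → (mem A ∩ mem B).Nonempty)
    (hconn : ∀ A, (S.induce (mem A)).Connected)
    (hmult : ∀ x, {A | x ∈ mem A}.encard ≤ ((d + 1 : ℕ) : ℕ∞)) :
    H.treewidth ≤ (d + 1) * (S.treewidth + 1) := by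
  classical
  have hne : {w : ℕ | ∃ (ι : Type) (_ : Finite ι) (T : SimpleGraph ι) (X : ι → Set V),
      S.IsTreeDecomposition T X ∧ ∀ t, (X t).encard ≤ w + 1}.Nonempty := by
    refine ⟨Nat.card V, Unit, inferInstance, ⊥, fun _ => Set.univ,
      ⟨IsTree.of_subsingleton, fun v => ⟨(), trivial⟩, fun v w _ => ⟨(), trivial, trivial⟩,
        fun v => ?_⟩, fun t => ?_⟩
    · have : {t : Unit | v ∈ (fun _ : Unit => (Set.univ : Set V)) t} = {()} := by
        ext t
        simp
      rw [this]
      exact induce_singleton_connected ()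
    · rw [Set.encard_univ, ← ENat.card_eq_coe_natCard]
      exact le_self_add
  obtain ⟨ι, hι, T, X, hT, hX⟩ := Nat.sInf_mem hne
  refine Nat.sInf_le ⟨ι, hι, T, fun t => {A | (mem A ∩ X t).Nonempty},
    ⟨hT.isTree, fun A => ?_, fun A B hAB => ?_, fun A => ?_⟩, fun t => ?_⟩
  · obtain ⟨x, hx⟩ := (hconn A).induce_nonempty
    obtain ⟨t, ht⟩ := hT.vertex_mem x
    exact ⟨t, x, hx, ht⟩
  · obtain ⟨x, hxA, hxB⟩ := hadj A B hAB
    obtain ⟨t, ht⟩ := hT.vertex_mem x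
    exact ⟨t, ⟨x, hxA, ht⟩, ⟨x, hxB, ht⟩⟩
  · obtain ⟨x₀, hx₀⟩ := (hconn A).induce_nonempty
    obtain ⟨t₀, ht₀⟩ := hT.vertex_mem x₀
    refine induce_connected_of_induction (r := t₀) ⟨x₀, hx₀, ht₀⟩ fun P hP hstep => ?_
    have hbag : ∀ x ∈ mem A, ∀ t t', x ∈ X t → x ∈ X t' → P t → P t' :=
      fun x hx t t' ht ht' hPt => (hT.connected x).induce_induction (r := t) ht hPt
        (fun v w hv hw => hstep v w ⟨x, hx, hv⟩ ⟨x, hx, hw⟩) ht'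
    have key : ∀ x ∈ mem A, ∀ t, x ∈ X t → P t := by
      intro x hx
      refine (hconn A).induce_induction (P := fun x => ∀ t, x ∈ X t → P t) hx₀
        (fun t ht => hbag x₀ hx₀ t₀ t ht₀ ht hP) ?_ hx
      intro v w hv hw hvw ih t ht
      obtain ⟨t', hvt, hwt⟩ := hT.edge_mem v w hvw
      exact hbag w hw t' t hwt ht (ih t' hvt)
    rintro t ⟨x, hx, ht⟩
    exact key x hx t ht
  · have hfin : (X t).Finite := Set.toFinite _
    have hbound : ∀ F : Finset V, {A | (mem A ∩ (F : Set V)).Nonempty}.encard ≤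
        F.card * ((d + 1 : ℕ) : ℕ∞) := by
      intro F
      induction F using Finset.induction_on with
      | empty => simp
      | insert a F ha ih =>
        have hsub : {A | (mem A ∩ ((insert a F : Finset V) : Set V)).Nonempty} ⊆
            {A | a ∈ mem A} ∪ {A | (mem A ∩ (F : Set V)).Nonempty} := by
          rintro A ⟨x, hxA, hx⟩
          rw [Finset.coe_insert] at hx
          rcases hx with rfl | hx
          · exact Or.inl hxA
          · exact Or.inr ⟨x, hxA, hx⟩
        refine (Set.encard_le_encard hsub).trans ((Set.encard_union_le _ _).trans ?_)
        rw [Finset.card_insert_of_notMem ha, Nat.cast_add, add_mul, add_comm]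
        exact add_le_add ih (by simpa using hmult a)
    have h1 := hbound hfin.toFinset
    rw [Set.Finite.coe_toFinset] at h1
    have h2 : hfin.toFinset.card ≤ S.treewidth + 1 := by
      have := hX t
      rw [hfin.encard_eq_coe_toFinset_card] at this
      exact_mod_cast this
    refine h1.trans ?_
    have h3 : hfin.toFinset.card * (d + 1) ≤ (d + 1) * (S.treewidth + 1) + 1 := by nlinarith
    exact_mod_cast h3

/-! ### Members of a sparse cover are local in the grid -/

variable {s : ℕ} {σ : V → Fin s × Fin s}

/-- A fibre of a contraction map that meets `mem A` but no shared vertex of `mem A` lies in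
`mem A`. -/
lemma IsSparseCover.mem_of_fiber (hS : IsSparseCover S H mem d)
    (hσ : ∀ p, (S.induce (σ ⁻¹' {p})).Connected) {A : W} {p : Fin s × Fin s}
    (hp : p ∈ σ '' mem A) (hp' : p ∉ σ '' shared mem A) {x : V} (hx : σ x = p) : x ∈ mem A := by
  obtain ⟨y, hy, rfl⟩ := hp
  refine (hσ (σ y)).induce_induction (r := y) rfl hy ?_ hx
  intro v w (hv : σ v = σ y) _ hvw hvA
  obtain ⟨B, hvB, hwB, -⟩ := hS.cut v w hvw
  by_cases hBA : B = A
  · exact hBA ▸ hwB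
  · exact (hp' ⟨v, ⟨hvA, B, hBA, hvB⟩, hv⟩).elim

/-- From a fibre without shared vertices of `mem A`, all adjacent fibres are met by `mem A`. -/
lemma IsSparseCover.mem_image_of_adj (hS : IsSparseCover S H mem d)
    (hσ : ∀ p, (S.induce (σ ⁻¹' {p})).Connected)
    (hadj : ∀ p q, (triangulatedGrid s).Adj p q → ∃ x y, σ x = p ∧ σ y = q ∧ S.Adj x y) {A : W}
    {p q : Fin s × Fin s} (hp : p ∈ σ '' mem A) (hp' : p ∉ σ '' shared mem A)
    (hpq : (triangulatedGrid s).Adj p q) : q ∈ σ '' mem A := by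
  obtain ⟨x, y, hx, rfl, hxy⟩ := hadj p q hpq
  obtain ⟨B, hxB, hyB, -⟩ := hS.cut x y hxy
  have hxA := hS.mem_of_fiber hσ hp hp' hx
  by_cases hBA : B = A
  · exact ⟨y, hBA ▸ hyB, rfl⟩
  · exact (hp' ⟨x, ⟨hxA, B, hBA, hxB⟩, hx⟩).elim

/-- By edge-minimality, no three pairwise adjacent fibres lie in `mem A` without shared vertices:
an edge between two of them would be redundant because of the third. -/
lemma IsSparseCover.no_triangle (hS : IsSparseCover S H mem d)
    (hσ : ∀ p, (S.induce (σ ⁻¹' {p})).Connected)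
    (hadj : ∀ p q, (triangulatedGrid s).Adj p q → ∃ x y, σ x = p ∧ σ y = q ∧ S.Adj x y) {A : W}
    {p₁ p₂ p₃ : Fin s × Fin s} (h₁ : p₁ ∈ σ '' mem A) (h₁' : p₁ ∉ σ '' shared mem A)
    (h₂ : p₂ ∈ σ '' mem A) (h₂' : p₂ ∉ σ '' shared mem A)
    (h₃ : p₃ ∈ σ '' mem A) (h₃' : p₃ ∉ σ '' shared mem A)
    (h₁₂ : (triangulatedGrid s).Adj p₁ p₂) (h₁₃ : (triangulatedGrid s).Adj p₁ p₃)
    (h₃₂ : (triangulatedGrid s).Adj p₃ p₂) : False := by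
  obtain ⟨u, v, hu, hv, huv⟩ := hadj p₁ p₂ h₁₂
  obtain ⟨B, huB, hvB, Y, huY, hvY, hY⟩ := hS.cut u v huv
  obtain rfl : B = A := by
    by_contra hBA
    exact h₁' ⟨u, ⟨hS.mem_of_fiber hσ h₁ h₁' hu, B, hBA, huB⟩, hu⟩
  have hf₁ : ∀ x, σ x = p₁ → x ∈ mem B := fun x => hS.mem_of_fiber hσ h₁ h₁'
  have hf₂ : ∀ x, σ x = p₂ → x ∈ mem B := fun x => hS.mem_of_fiber hσ h₂ h₂'
  have hf₃ : ∀ x, σ x = p₃ → x ∈ mem B := fun x => hS.mem_of_fiber hσ h₃ h₃'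
  -- The set `Y` can only be left through the edge from `u` to `v`.
  have hstep : ∀ x ∈ mem B, ∀ y ∈ mem B, S.Adj x y → (x = u → y = v → False) → x ∈ Y → y ∈ Y := by
    intro x hx y hy hxy hne hxY
    by_contra hyY
    obtain ⟨h, h'⟩ := hY x hx y hy hxy hxY hyY
    exact hne h h'
  have hY₁ : ∀ x, σ x = p₁ → x ∈ Y := fun x hx => (hσ p₁).induce_induction (r := u) hu huY
    (fun a b (ha : σ a = p₁) (hb : σ b = p₁) hab => hstep a (hf₁ a ha) b (hf₁ b hb) hab
      fun _ hbv => h₁₂.ne (hb.symm.trans (hbv ▸ hv))) hx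
  have hY₃ : ∀ x, σ x = p₃ → x ∈ Y := by
    intro x hx
    obtain ⟨a, b, ha, hb, hab⟩ := hadj p₁ p₃ h₁₃
    have hbY : b ∈ Y := hstep a (hf₁ a ha) b (hf₃ b hb) hab
      (fun _ hbv => h₃₂.ne (hb.symm.trans (hbv ▸ hv))) (hY₁ a ha)
    exact (hσ p₃).induce_induction (r := b) hb hbY
      (fun a b (ha : σ a = p₃) (hb : σ b = p₃) hab => hstep a (hf₃ a ha) b (hf₃ b hb) hab
        fun _ hbv => h₃₂.ne (hb.symm.trans (hbv ▸ hv))) hx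
  obtain ⟨a, b, ha, hb, hab⟩ := hadj p₃ p₂ h₃₂
  have hbY : b ∈ Y := hstep a (hf₃ a ha) b (hf₂ b hb) hab
    (fun hau _ => h₁₃.ne (hu.symm.trans (hau ▸ ha))) (hY₃ a ha)
  exact hvY ((hσ p₂).induce_induction (r := b) hb hbY
    (fun a b (ha : σ a = p₂) (hb : σ b = p₂) hab => hstep a (hf₂ a ha) b (hf₂ b hb) hab
      fun hau _ => h₁₂.ne (hu.symm.trans (hau ▸ ha))) hv)

/-- A connected set of grid points that contains a triangle and meets the image of `mem A` also
meets the image of the shared vertices of `mem A`. -/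
lemma IsSparseCover.exists_shared_mem (hS : IsSparseCover S H mem d)
    (hσ : ∀ p, (S.induce (σ ⁻¹' {p})).Connected)
    (hadj : ∀ p q, (triangulatedGrid s).Adj p q → ∃ x y, σ x = p ∧ σ y = q ∧ S.Adj x y) {A : W}
    {X : Set (Fin s × Fin s)} (hX : ((triangulatedGrid s).induce X).Connected)
    {p₁ p₂ p₃ : Fin s × Fin s} (h₁ : p₁ ∈ X) (h₂ : p₂ ∈ X) (h₃ : p₃ ∈ X)
    (h₁₂ : (triangulatedGrid s).Adj p₁ p₂) (h₁₃ : (triangulatedGrid s).Adj p₁ p₃)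
    (h₃₂ : (triangulatedGrid s).Adj p₃ p₂) {a : Fin s × Fin s} (ha : a ∈ X)
    (ha' : a ∈ σ '' mem A) : ∃ p ∈ X, p ∈ σ '' shared mem A := by
  by_contra! hno
  have hall : ∀ p ∈ X, p ∈ σ '' mem A := fun p hp => hX.induce_induction ha ha'
    (fun v w hv _ hvw hv' => hS.mem_image_of_adj hσ hadj hv' (hno v hv) hvw) hp
  exact hS.no_triangle hσ hadj (hall _ h₁) (hno _ h₁) (hall _ h₂) (hno _ h₂) (hall _ h₃)
    (hno _ h₃) h₁₂ h₁₃ h₃₂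

/-- Every point of the image of `mem A` lies in a column next to the image of a shared vertex,
since two adjacent columns form a connected set containing a triangle. -/
lemma IsSparseCover.exists_shared_fst (hS : IsSparseCover S H mem d)
    (hσ : ∀ p, (S.induce (σ ⁻¹' {p})).Connected)
    (hadj : ∀ p q, (triangulatedGrid s).Adj p q → ∃ x y, σ x = p ∧ σ y = q ∧ S.Adj x y)
    (hs : 2 ≤ s) {A : W} {a : Fin s × Fin s} (ha : a ∈ σ '' mem A) :
    ∃ p ∈ σ '' shared mem A, (p.1 : ℕ) ≤ a.1 + 1 ∧ (a.1 : ℕ) ≤ p.1 + 1 := by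
  obtain ⟨x, hx, hxa⟩ : ∃ x, x + 1 < s ∧ (x = a.1 ∨ x + 1 = a.1) := by
    rcases Nat.eq_zero_or_pos (a.1 : ℕ) with h | h
    · exact ⟨0, by omega⟩
    · exact ⟨a.1 - 1, by omega⟩
  obtain ⟨p, ⟨h1, h2, -, -⟩, hp⟩ := hS.exists_shared_mem hσ hadj (A := A)
    (X := rect s x (x + 1) 0 (s - 1))
    (p₁ := (⟨x, by omega⟩, ⟨0, by omega⟩)) (p₂ := (⟨x + 1, by omega⟩, ⟨0, by omega⟩))
    (p₃ := (⟨x, by omega⟩, ⟨1, by omega⟩))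
    (rect_connected (by omega) (by omega) (by omega) (by omega))
    (by simp [rect]) (by simp [rect]) (by simp only [rect, Set.mem_ofPred_eq]; omega)
    (adj_of_fst_eq_add_one rfl rfl) (adj_of_snd_eq_add_one rfl rfl) (adj_diagonal rfl rfl).symm
    (a := a) (by simp only [rect, Set.mem_ofPred_eq]; omega) ha
  exact ⟨p, hp, by omega⟩

lemma IsSparseCover.exists_shared_snd (hS : IsSparseCover S H mem d)
    (hσ : ∀ p, (S.induce (σ ⁻¹' {p})).Connected)
    (hadj : ∀ p q, (triangulatedGrid s).Adj p q → ∃ x y, σ x = p ∧ σ y = q ∧ S.Adj x y)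
    (hs : 2 ≤ s) {A : W} {a : Fin s × Fin s} (ha : a ∈ σ '' mem A) :
    ∃ p ∈ σ '' shared mem A, (p.2 : ℕ) ≤ a.2 + 1 ∧ (a.2 : ℕ) ≤ p.2 + 1 := by
  obtain ⟨x, hx, hxa⟩ : ∃ x, x + 1 < s ∧ (x = a.2 ∨ x + 1 = a.2) := by
    rcases Nat.eq_zero_or_pos (a.2 : ℕ) with h | h
    · exact ⟨0, by omega⟩
    · exact ⟨a.2 - 1, by omega⟩
  obtain ⟨p, ⟨-, -, h1, h2⟩, hp⟩ := hS.exists_shared_mem hσ hadj (A := A)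
    (X := rect s 0 (s - 1) x (x + 1))
    (p₁ := (⟨0, by omega⟩, ⟨x, by omega⟩)) (p₂ := (⟨1, by omega⟩, ⟨x, by omega⟩))
    (p₃ := (⟨0, by omega⟩, ⟨x + 1, by omega⟩))
    (rect_connected (by omega) (by omega) (by omega) (by omega))
    (by simp [rect]) (by simp only [rect, Set.mem_ofPred_eq]; omega) (by simp [rect])
    (adj_of_fst_eq_add_one rfl rfl) (adj_of_snd_eq_add_one rfl rfl) (adj_diagonal rfl rfl).symm
    (a := a) (by simp only [rect, Set.mem_ofPred_eq]; omega) ha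
  exact ⟨p, hp, by omega⟩

/-- Along a chain of steps that change the coordinate `g` by at most one, `g` takes all intermediate
values; if they are all next to values of `g` on a finite set `F`, then `g` grows by at most
`3 * |F|`. -/
lemma le_add_of_chain {α : Type*} {Z : Set α} {r : α → α → Prop} {g : α → ℕ} (F : Finset α)
    (hr : ∀ p q, r p q → q ∈ Z ∧ g q ≤ g p + 1)
    (hF : ∀ p ∈ Z, ∃ q ∈ F, g q ≤ g p + 1 ∧ g p ≤ g q + 1) {a b : α} (ha : a ∈ Z)
    (hab : Relation.ReflTransGen r a b) : g b ≤ g a + 3 * F.card := by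
  classical
  have hivt : ∀ n, g a ≤ n → n ≤ g b → ∃ p ∈ Z, g p = n := by
    induction hab with
    | refl => exact fun n h h' => ⟨a, ha, le_antisymm h h'⟩
    | tail _ hbc ih =>
      intro n hn hn'
      rename_i b c _
      by_cases h : n ≤ g b
      · exact ih n hn h
      · obtain ⟨hc, hgc⟩ := hr _ _ hbc
        exact ⟨c, hc, by omega⟩
  have hsub : Finset.Icc (g a) (g b) ⊆ F.biUnion fun q => Finset.Icc (g q - 1) (g q + 1) := by
    intro n hn
    rw [Finset.mem_Icc] at hn
    obtain ⟨p, hp, rfl⟩ := hivt n hn.1 hn.2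
    obtain ⟨q, hq, h1, h2⟩ := hF p hp
    rw [Finset.mem_biUnion]
    exact ⟨q, hq, by rw [Finset.mem_Icc]; omega⟩
  have h1 := (Finset.card_le_card hsub).trans
    (Finset.card_biUnion_le_card_mul _ _ 3 fun q _ => by rw [Nat.card_Icc]; omega)
  rw [Nat.card_Icc] at h1
  omega

/-- From any point of a connected set of grid points, short steps in the set lead to any other point
or to the boundary of the square. -/
lemma exists_chain {Z : Set (Fin s × Fin s)} (hZ : ((triangulatedGrid s).induce Z).Connected)
    {a b : Fin s × Fin s} (ha : a ∈ Z) (hb : b ∈ Z) :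
    Relation.ReflTransGen (fun p q => p ∈ Z ∧ q ∈ Z ∧ Near 1 p q) a b ∨
      ∃ o ∈ frame s, o ∈ Z ∧
        Relation.ReflTransGen (fun p q => p ∈ Z ∧ q ∈ Z ∧ Near 1 p q) a o := by
  refine hZ.induce_induction (P := fun a =>
    Relation.ReflTransGen (fun p q => p ∈ Z ∧ q ∈ Z ∧ Near 1 p q) a b ∨
      ∃ o ∈ frame s, o ∈ Z ∧
        Relation.ReflTransGen (fun p q => p ∈ Z ∧ q ∈ Z ∧ Near 1 p q) a o) hb (Or.inl .refl) ?_ ha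
  intro v w hv hw hvw ih
  rcases near_one_or_mem_frame_of_adj hvw with h | ⟨-, h⟩
  · rcases ih with h' | ⟨o, ho, hoZ, h'⟩
    · exact Or.inl (.head ⟨hw, hv, h.symm⟩ h')
    · exact Or.inr ⟨o, ho, hoZ, .head ⟨hw, hv, h.symm⟩ h'⟩
  · exact Or.inr ⟨w, h, hw, .refl⟩

/-- The image of `mem A` is small up to shortcuts along the boundary: along a chain of short steps,
all coordinates occur next to the images of the at most `d` shared vertices. -/
lemma IsSparseCover.isLocal_image [Finite V] (hS : IsSparseCover S H mem d)
    (hσ : ∀ p, (S.induce (σ ⁻¹' {p})).Connected)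
    (hadj : ∀ p q, p ≠ q →
      ((triangulatedGrid s).Adj p q ↔ ∃ x y, σ x = p ∧ σ y = q ∧ S.Adj x y))
    (hs : 2 ≤ s) (A : W) : IsLocal (3 * d) (σ '' mem A) := by
  classical
  have hadj' : ∀ p q, (triangulatedGrid s).Adj p q → ∃ x y, σ x = p ∧ σ y = q ∧ S.Adj x y :=
    fun p q h => (hadj p q h.ne).1 h
  have hZ : ((triangulatedGrid s).induce (σ '' mem A)).Connected := by
    obtain ⟨x₀, hx₀⟩ := (hS.connected A).induce_nonempty
    refine induce_connected_of_induction (Set.mem_image_of_mem σ hx₀) ?_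
    rintro P hP hstep _ ⟨x, hx, rfl⟩
    refine (hS.connected A).induce_induction (P := fun x => P (σ x)) hx₀ hP ?_ hx
    intro v w hv hw hvw hPv
    by_cases h : σ v = σ w
    · exact h ▸ hPv
    · exact hstep _ _ (Set.mem_image_of_mem σ hv) (Set.mem_image_of_mem σ hw)
        ((hadj _ _ h).2 ⟨v, w, rfl, rfl, hvw⟩) hPv
  have hfin : (σ '' shared mem A).Finite := Set.toFinite _
  have hcard : hfin.toFinset.card ≤ d := by
    rw [← Set.ncard_eq_toFinset_card _ hfin]
    exact (Set.ncard_image_le (Set.toFinite _)).trans (hS.card_shared A)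
  have hchain : ∀ a ∈ σ '' mem A, ∀ b, Relation.ReflTransGen
      (fun p q => p ∈ σ '' mem A ∧ q ∈ σ '' mem A ∧ Near 1 p q) a b → Near (3 * d) a b := by
    intro a ha b hab
    have hbZ : b ∈ σ '' mem A := by
      cases hab with
      | refl => exact ha
      | tail _ h => exact h.2.1
    have : Std.Symm fun p q : Fin s × Fin s =>
        p ∈ σ '' mem A ∧ q ∈ σ '' mem A ∧ Near 1 p q := ⟨fun p q h => ⟨h.2.1, h.1, h.2.2.symm⟩⟩
    have hba : Relation.ReflTransGen
        (fun p q => p ∈ σ '' mem A ∧ q ∈ σ '' mem A ∧ Near 1 p q) b a :=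
      Relation.ReflTransGen.stdSymm.symm _ _ hab
    have h1 : ∀ p ∈ σ '' mem A, ∃ q ∈ hfin.toFinset, (q.1 : ℕ) ≤ p.1 + 1 ∧ (p.1 : ℕ) ≤ q.1 + 1 :=
      fun p hp => by
        obtain ⟨q, hq, h⟩ := hS.exists_shared_fst hσ hadj' hs hp
        exact ⟨q, hfin.mem_toFinset.2 hq, h⟩
    have h2 : ∀ p ∈ σ '' mem A, ∃ q ∈ hfin.toFinset, (q.2 : ℕ) ≤ p.2 + 1 ∧ (p.2 : ℕ) ≤ q.2 + 1 :=
      fun p hp => by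
        obtain ⟨q, hq, h⟩ := hS.exists_shared_snd hσ hadj' hs hp
        exact ⟨q, hfin.mem_toFinset.2 hq, h⟩
    have e1 := le_add_of_chain (g := fun p : Fin s × Fin s => (p.1 : ℕ)) hfin.toFinset
      (fun p q h => ⟨h.2.1, h.2.2.2.1⟩) h1 ha hab
    have e2 := le_add_of_chain (g := fun p : Fin s × Fin s => (p.1 : ℕ)) hfin.toFinset
      (fun p q h => ⟨h.2.1, h.2.2.2.1⟩) h1 hbZ hba
    have e3 := le_add_of_chain (g := fun p : Fin s × Fin s => (p.2 : ℕ)) hfin.toFinset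
      (fun p q h => ⟨h.2.1, h.2.2.2.2.2⟩) h2 ha hab
    have e4 := le_add_of_chain (g := fun p : Fin s × Fin s => (p.2 : ℕ)) hfin.toFinset
      (fun p q h => ⟨h.2.1, h.2.2.2.2.2⟩) h2 hbZ hba
    unfold Near
    omega
  intro a ha b hb
  rcases exists_chain hZ ha hb with h | ⟨o, ho, hoZ, h⟩
  · exact Or.inl (hchain a ha b h)
  rcases exists_chain hZ hb ha with h' | ⟨o', ho', -, h'⟩
  · exact Or.inl (hchain b hb a h').symm
  · exact Or.inr ⟨⟨o, ho, hoZ⟩, ⟨o, ho, hchain a ha o h⟩, o', ho', hchain b hb o' h'⟩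

/-- The factor by which the triangulated grid shrinks when passing from a graph to a sparse
intersection graph of its connected sets. -/
def gridFactor (d : ℕ) : ℕ := 10 * (driftBound (3 * d) + 1)

/-- A large triangulated grid contraction of the base graph gives a smaller one of the intersection
graph. -/
theorem IsSparseCover.isContraction [Finite V] [Finite W] (hS : IsSparseCover S H mem d) {t : ℕ}
    (ht : 0 < t) (h : (triangulatedGrid (gridFactor d * t)).IsContraction S) :
    (triangulatedGrid t).IsContraction H := by
  obtain ⟨σ, -, hσ, hadj⟩ := h
  have hadj' : ∀ p q, p ≠ q → ((triangulatedGrid (gridFactor d * t)).Adj p q ↔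
      ∃ x y, σ x = p ∧ σ y = q ∧ S.Adj x y) := by
    intro p q hpq
    rw [hadj p q hpq, induce_union_connected_iff_exists_adj (hσ p) (hσ q)
      (fun v hv hv' => hpq (hv.symm.trans hv'))]
    constructor
    · rintro ⟨x, hx, y, hy, hxy⟩
      exact ⟨x, y, hx, hy, hxy⟩
    · rintro ⟨x, y, hx, hy, hxy⟩
      exact ⟨x, hx, y, hy, hxy⟩
  have hs : 2 ≤ gridFactor d * t := by
    unfold gridFactor
    nlinarith
  refine isContraction_of_isCoarseDrawing (Z := fun A => σ '' mem A) (m := 3 * d)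
    (Q := fun i => brickCore _ (driftBound (3 * d) + 1) (3 * d) i)
    (fun A B hAB => ?_) (fun X hX => ?_) (fun A => ?_) (hS.isLocal_image hσ hadj' hs)
    (isCoarseDrawing_brickCore (by unfold driftBound; omega) (Nat.lt_succ_self _) ht
      (by unfold gridFactor; ring))
  · obtain ⟨x, hxA, hxB⟩ := ((hS.adj_iff A B).1 hAB).2
    exact ⟨σ x, ⟨x, hxA, rfl⟩, ⟨x, hxB, rfl⟩⟩
  · have := hS.touch_connected (induce_preimage_connected hσ
      (fun p q hpq => (hadj' p q hpq.ne).1 hpq) hX)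
    have heq : {A | (σ '' mem A ∩ X).Nonempty} = {A | (mem A ∩ σ ⁻¹' X).Nonempty} :=
      Set.ext fun A => Set.image_inter_nonempty_iff
    rw [heq]
    exact this
  · exact (hS.connected A).induce_nonempty.image σ

end SparseCover

/-! ### Intersection graphs in a monotone class -/

/-- A finite graph has an edge-minimal spanning subgraph in which the members of a given family of
connected sets stay connected. In it, every edge is the only edge across some cut of some member of
the family. -/
lemma exists_minimal_connecting {V : Type*} [Finite V] (G : SimpleGraph V) (𝒞 : Set (Set V))
    (h𝒞 : ∀ A ∈ 𝒞, (G.induce A).Connected) :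
    ∃ S ≤ G, (∀ A ∈ 𝒞, (S.induce A).Connected) ∧ ∀ u v, S.Adj u v → ∃ A ∈ 𝒞, u ∈ A ∧ v ∈ A ∧
      ∃ Y : Set V, u ∈ Y ∧ v ∉ Y ∧
        ∀ x ∈ A, ∀ y ∈ A, S.Adj x y → x ∈ Y → y ∉ Y → x = u ∧ y = v := by
  classical
  obtain ⟨S, hSG, hS, hmin⟩ := exists_minimal_le_of_wellFoundedLT
    (fun S : SimpleGraph V => ∀ A ∈ 𝒞, (S.induce A).Connected) G h𝒞
  refine ⟨S, hSG, hS, fun u v huv => ?_⟩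
  have hdel : ¬ ∀ A ∈ 𝒞, ((S.deleteEdges {s(u, v)}).induce A).Connected := by
    intro h
    have := hmin h (deleteEdges_le _) huv
    simp at this
  push Not at hdel
  obtain ⟨A, hA, hAc⟩ := hdel
  have hadj : ∀ x y, S.Adj x y → s(x, y) ≠ s(u, v) → (S.deleteEdges {s(u, v)}).Adj x y :=
    fun x y h h' => by simpa [deleteEdges_adj, h] using h'
  have huA : u ∈ A := by
    by_contra huA
    obtain ⟨r, hr⟩ := (hS A hA).induce_nonempty
    refine hAc (induce_connected_of_induction hr fun P hP hstep w hw =>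
      (hS A hA).induce_induction hr hP (fun x y hx hy hxy => hstep x y hx hy (hadj x y hxy ?_)) hw)
    intro h
    rcases Sym2.eq_iff.1 h with ⟨rfl, -⟩ | ⟨-, rfl⟩
    · exact huA hx
    · exact huA hy
  have hvA : v ∈ A := by
    by_contra hvA
    refine hAc (induce_connected_of_induction huA fun P hP hstep w hw =>
      (hS A hA).induce_induction huA hP
        (fun x y hx hy hxy => hstep x y hx hy (hadj x y hxy ?_)) hw)
    intro h
    rcases Sym2.eq_iff.1 h with ⟨-, rfl⟩ | ⟨rfl, -⟩
    · exact hvA hy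
    · exact hvA hx
  -- `Y` is the component of `u` in `A` after the removal of the edge `uv`.
  let Y : Set V := {x | ∀ P : V → Prop, P u → (∀ x y, x ∈ A → y ∈ A →
    (S.deleteEdges {s(u, v)}).Adj x y → P x → P y) → P x}
  have hvY : v ∉ Y := by
    intro hvY
    refine hAc (induce_connected_of_induction huA fun P hP hstep w hw =>
      (hS A hA).induce_induction huA hP (fun x y hx hy hxy hPx => ?_) hw)
    by_cases h : s(x, y) = s(u, v)
    · rcases Sym2.eq_iff.1 h with ⟨-, rfl⟩ | ⟨-, rfl⟩
      · exact hvY P hP hstep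
      · exact hP
    · exact hstep x y hx hy (hadj x y hxy h) hPx
  refine ⟨A, hA, huA, hvA, Y, fun P hP _ => hP, hvY, fun x hx y hy hxy hxY hyY => ?_⟩
  by_cases h : s(x, y) = s(u, v)
  · rcases Sym2.eq_iff.1 h with h | ⟨rfl, -⟩
    · exact h
    · exact (hvY hxY).elim
  · exact (hyY fun P hP hstep => hstep x y hx hy (hadj x y hxy h) (hxY P hP hstep)).elim

end SimpleGraph

namespace FinGraph

open SimpleGraph

section InterDeg

variable {G : FinGraph.{u}} {𝒞 : Set (Set G.graph.vertexSet)} {d : ℕ}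

/-- The subgraph of `G` on the vertices covered by `𝒞`, with all those edges that join neighbours of
the simple graph `S`. -/
def coverGraph (G : FinGraph.{u}) (𝒞 : Set (Set G.graph.vertexSet))
    (S : SimpleGraph G.graph.vertexSet) (hS : ∀ x y, S.Adj x y → ∃ A ∈ 𝒞, x ∈ A ∧ y ∈ A) :
    Graph G.α G.β where
  vertexSet := {x | ∃ A ∈ 𝒞, ∃ hx : x ∈ G.graph.vertexSet, (⟨x, hx⟩ : G.graph.vertexSet) ∈ A}
  IsLink e x y := G.graph.IsLink e x y ∧ ∃ (hx : x ∈ G.graph.vertexSet)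
    (hy : y ∈ G.graph.vertexSet), S.Adj ⟨x, hx⟩ ⟨y, hy⟩
  isLink_symm _ _ := ⟨fun _ _ ⟨h, hx, hy, h'⟩ => ⟨h.symm, hy, hx, h'.symm⟩⟩
  eq_or_eq_of_isLink_of_isLink := fun _ _ _ _ _ h h' => h.1.left_eq_or_eq h'.1
  left_mem_of_isLink := fun _ x y ⟨_, hx, hy, h⟩ => by
    obtain ⟨A, hA, hxA, -⟩ := hS _ _ h
    exact ⟨A, hA, hx, hxA⟩

lemma coverGraph_le (S : SimpleGraph G.graph.vertexSet)
    (hS : ∀ x y, S.Adj x y → ∃ A ∈ 𝒞, x ∈ A ∧ y ∈ A) : G.coverGraph 𝒞 S hS ≤ G.graph where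
  vertexSet_mono := fun _ ⟨_, _, hx, _⟩ => hx
  isLink_mono := fun _ _ _ h => h.1

lemma simple_adj_iff (G : FinGraph.{u}) (x y : G.graph.vertexSet) :
    G.simple.Adj x y ↔ ∃ e, G.graph.IsLink e x y :=
  have := G.loopless
  Graph.toSimpleGraph_adj_iff x y

/-- A vertex of the intersection graph, as a vertex set of `G`. -/
def memberSet (A : (G.intersectionGraph 𝒞).graph.vertexSet) : Set G.graph.vertexSet := A.1

lemma memberSet_mem (A : (G.intersectionGraph 𝒞).graph.vertexSet) : memberSet A ∈ 𝒞 := A.2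

lemma memberSet_injective : Function.Injective (memberSet (G := G) (𝒞 := 𝒞)) :=
  fun _ _ h => Subtype.ext h

lemma intersectionGraph_adj_iff (A B : (G.intersectionGraph 𝒞).graph.vertexSet) :
    (G.intersectionGraph 𝒞).simple.Adj A B ↔ A ≠ B ∧ (memberSet A ∩ memberSet B).Nonempty := by
  rw [simple_adj_iff]
  constructor
  · rintro ⟨e, -, -, hne, -, he⟩
    exact ⟨fun h => hne (congrArg Subtype.val h), e.2, he⟩
  · rintro ⟨hne, x, hx⟩
    exact ⟨(s(memberSet A, memberSet B), x), A.2, B.2, fun h => hne (Subtype.ext h), rfl, hx⟩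

lemma finite_incidenceSet (A : (G.intersectionGraph 𝒞).α) :
    ((G.intersectionGraph 𝒞).graph.incidenceSet A).Finite :=
  (G.intersectionGraph 𝒞).finite_edgeSet.subset (Graph.incidenceSet_subset_edgeSet _)

/-- If all edge-degrees are at most `d`, then a member of `𝒞` has at most `d` vertices that lie in
another member. -/
lemma ncard_shared_le
    (hd : ∀ A ∈ (G.intersectionGraph 𝒞).graph.vertexSet, (G.intersectionGraph 𝒞).edgeDegree A ≤ d)
    (A : (G.intersectionGraph 𝒞).graph.vertexSet) :
    (shared (memberSet (G := G) (𝒞 := 𝒞)) A).ncard ≤ d := by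
  classical
  refine le_trans ?_ (hd A.1 A.2)
  have hB : ∀ x : G.graph.vertexSet, ∃ B : Set G.graph.vertexSet,
      x ∈ shared (memberSet (G := G) (𝒞 := 𝒞)) A →
        B ∈ 𝒞 ∧ memberSet A ≠ B ∧ x ∈ B := by
    intro x
    by_cases hx : x ∈ shared (memberSet (G := G) (𝒞 := 𝒞)) A
    · obtain ⟨-, B, hBA, hxB⟩ := hx
      exact ⟨memberSet B, fun _ => ⟨B.2, fun h => hBA (Subtype.ext h.symm), hxB⟩⟩
    · exact ⟨∅, fun h => (hx h).elim⟩
  choose B hB using hB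
  refine Set.ncard_le_ncard_of_injOn (fun x => (s(memberSet A, B x), x)) (fun x hx => ?_)
    (fun x _ y _ h => (Prod.ext_iff.1 h).2) (finite_incidenceSet A.1)
  obtain ⟨h1, h2, h3⟩ := hB x hx
  exact ⟨B x, A.2, h1, h2, rfl, hx.1, h3⟩

/-- If all edge-degrees are at most `d`, then every vertex lies in at most `d + 1` members of
`𝒞`. -/
lemma encard_mem_le
    (hd : ∀ A ∈ (G.intersectionGraph 𝒞).graph.vertexSet, (G.intersectionGraph 𝒞).edgeDegree A ≤ d)
    (x : G.graph.vertexSet) :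
    {A : (G.intersectionGraph 𝒞).graph.vertexSet | x ∈ memberSet A}.encard ≤
      ((d + 1 : ℕ) : ℕ∞) := by
  by_cases hx : ∃ A : (G.intersectionGraph 𝒞).graph.vertexSet, x ∈ memberSet A
  · obtain ⟨A, hA⟩ := hx
    have hsub : {A : (G.intersectionGraph 𝒞).graph.vertexSet | x ∈ memberSet A} ⊆
        insert A {B : (G.intersectionGraph 𝒞).graph.vertexSet | B ≠ A ∧ x ∈ memberSet B} := by
      intro B hB
      by_cases hBA : B = A
      · exact Or.inl hBA
      · exact Or.inr ⟨hBA, hB⟩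
    have hinj : {B : (G.intersectionGraph 𝒞).graph.vertexSet | B ≠ A ∧ x ∈ memberSet B}.encard ≤
        ((G.intersectionGraph 𝒞).graph.incidenceSet A.1).encard := by
      refine Set.encard_le_encard_of_injOn (f := fun B => (s(memberSet A, memberSet B), x)) ?_ ?_
      · rintro B ⟨hBA, hxB⟩
        exact ⟨B.1, A.2, B.2, fun h => hBA (Subtype.ext h.symm), rfl, hA, hxB⟩
      · rintro B ⟨hBA, -⟩ C - h
        rcases Sym2.eq_iff.1 (Prod.ext_iff.1 h).1 with ⟨-, h'⟩ | ⟨-, h'⟩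
        · exact memberSet_injective h'
        · exact (hBA (memberSet_injective h')).elim
    have hA' : ((G.intersectionGraph 𝒞).graph.incidenceSet A.1).encard ≤ (d : ℕ∞) := by
      rw [← (finite_incidenceSet A.1).cast_ncard_eq]
      exact_mod_cast hd A.1 A.2
    refine (Set.encard_le_encard hsub).trans ((Set.encard_insert_le _ _).trans ?_)
    push_cast
    exact add_le_add (hinj.trans hA') le_rfl
  · push Not at hx
    have : {A : (G.intersectionGraph 𝒞).graph.vertexSet | x ∈ memberSet A} = ∅ :=
      Set.eq_empty_of_forall_notMem hx
    simp [this]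

/-- An intersection graph of connected sets of `G` with edge-degrees at most `d` is controlled by a
subgraph of `G`, in treewidth and in the triangulated grids that are contractions. -/
theorem exists_subgraph_of_intersectionGraph (h𝒞 : 𝒞 ⊆ G.connectedSets)
    (hd : ∀ A ∈ (G.intersectionGraph 𝒞).graph.vertexSet,
      (G.intersectionGraph 𝒞).edgeDegree A ≤ d) :
    ∃ (F : Graph G.α G.β) (hF : F ≤ G.graph),
      (G.intersectionGraph 𝒞).treewidth ≤ (d + 1) * ((G.ofLE F hF).treewidth + 1) ∧
      (∀ t, 0 < t → (triangulatedGrid (gridFactor d * t)).IsContraction (G.ofLE F hF).simple →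
        (triangulatedGrid t).IsContraction (G.intersectionGraph 𝒞).simple) ∧
      ((G.intersectionGraph 𝒞).Connected → (G.ofLE F hF).Connected) := by
  have hfinV : Finite G.graph.vertexSet := G.finite_vertexSet
  obtain ⟨S, hSG, hSc, hcut⟩ := exists_minimal_connecting G.simple 𝒞 h𝒞
  have hedge : ∀ x y, S.Adj x y → ∃ A ∈ 𝒞, x ∈ A ∧ y ∈ A := fun x y h => by
    obtain ⟨A, hA, hx, hy, -⟩ := hcut x y h
    exact ⟨A, hA, hx, hy⟩
  have hF := coverGraph_le (G := G) (𝒞 := 𝒞) S hedge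
  set G' := G.ofLE (G.coverGraph 𝒞 S hedge) hF with hG'
  let ι : G'.graph.vertexSet → G.graph.vertexSet := fun x => ⟨x.1, hF.1 x.2⟩
  have hιinj : ∀ x y, ι x = ι y → x = y := fun x y h =>
    Subtype.ext (show (ι x).1 = (ι y).1 by rw [h])
  have hιsurj : ∀ A ∈ 𝒞, ∀ x ∈ A, ∃ x', ι x' = x :=
    fun A hA x hx => ⟨⟨x.1, A, hA, x.2, hx⟩, rfl⟩
  have hadj : ∀ x y, G'.simple.Adj x y ↔ S.Adj (ι x) (ι y) := by
    intro x y
    rw [simple_adj_iff]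
    constructor
    · rintro ⟨e, -, hx, hy, h⟩
      exact h
    · intro h
      obtain ⟨e, he⟩ := (simple_adj_iff G _ _).1 (hSG h)
      exact ⟨e, he, (ι x).2, (ι y).2, h⟩
  let mem : (G.intersectionGraph 𝒞).graph.vertexSet → Set G'.graph.vertexSet :=
    fun A => ι ⁻¹' memberSet A
  have hcover : IsSparseCover G'.simple (G.intersectionGraph 𝒞).simple mem d := by
    refine ⟨fun A B => ?_, fun A => ?_, fun x => ?_, fun u v huv => ?_, fun A => ?_⟩
    · rw [intersectionGraph_adj_iff]
      refine and_congr_right fun _ => ⟨?_, ?_⟩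
      · rintro ⟨x, hxA, hxB⟩
        obtain ⟨x, rfl⟩ := hιsurj _ (memberSet_mem A) x hxA
        exact ⟨x, hxA, hxB⟩
      · rintro ⟨x, hxA, hxB⟩
        exact ⟨ι x, hxA, hxB⟩
    · obtain ⟨r, hr⟩ := (hSc _ (memberSet_mem A)).induce_nonempty
      obtain ⟨r, rfl⟩ := hιsurj _ (memberSet_mem A) r hr
      refine induce_connected_of_induction (r := r) hr fun P hP hstep w hw => ?_
      refine (hSc _ (memberSet_mem A)).induce_induction (P := fun x => ∀ x', ι x' = x → P x') hr
        (fun x' hx' => hιinj _ _ hx' ▸ hP) ?_ hw w rfl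
      rintro v w hv hw hvw ih w' rfl
      obtain ⟨v', rfl⟩ := hιsurj _ (memberSet_mem A) v hv
      exact hstep v' w' hv hw ((hadj _ _).2 hvw) (ih v' rfl)
    · obtain ⟨A, hA, hx, hxA⟩ := x.2
      exact ⟨⟨A, hA⟩, hxA⟩
    · obtain ⟨A, hA, huA, hvA, Y, huY, hvY, hY⟩ := hcut _ _ ((hadj u v).1 huv)
      refine ⟨⟨A, hA⟩, huA, hvA, ι ⁻¹' Y, huY, hvY, fun x hx y hy hxy hxY hyY => ?_⟩
      obtain ⟨h1, h2⟩ := hY (ι x) hx (ι y) hy ((hadj x y).1 hxy) hxY hyY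
      exact ⟨hιinj _ _ h1, hιinj _ _ h2⟩
    · refine le_trans ?_ (ncard_shared_le hd A)
      exact Set.ncard_le_ncard_of_injOn ι (fun x hx => hx) (fun x _ y _ h => hιinj x y h)
        (Set.toFinite _)
  have hfinV' : Finite G'.graph.vertexSet := G'.finite_vertexSet
  have hfinW : Finite (G.intersectionGraph 𝒞).graph.vertexSet :=
    (G.intersectionGraph 𝒞).finite_vertexSet
  refine ⟨_, hF, ?_, fun t ht h => hcover.isContraction ht h, fun hconn => ?_⟩
  · exact treewidth_le_of_cover (mem := mem) (fun A B h => ((hcover.adj_iff A B).1 h).2)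
      hcover.connected (fun x => encard_mem_le hd (ι x))
  · -- Reachability from `r` spreads over each member of `𝒞`, and along a path of the intersection
    -- graph from one member to the next through a common vertex.
    obtain ⟨A₀⟩ := hconn.nonempty
    obtain ⟨r, hr⟩ := (hcover.connected A₀).induce_nonempty
    have hall : ∀ A, ∀ x ∈ mem A, G'.simple.Reachable r x := by
      have hin : ∀ A, ∀ x ∈ mem A, ∀ y ∈ mem A, G'.simple.Reachable r x →
          G'.simple.Reachable r y := fun A x hx y hy h =>
        (hcover.connected A).induce_induction hx h
          (fun v w _ _ hvw hv => hv.trans hvw.reachable) hy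
      have hstep : ∀ {A B}, (G.intersectionGraph 𝒞).simple.Walk A B →
          (∀ x ∈ mem A, G'.simple.Reachable r x) → ∀ x ∈ mem B, G'.simple.Reachable r x := by
        intro A B p
        induction p with
        | nil => exact id
        | cons hAC _ ih =>
          intro hA
          obtain ⟨y, hyA, hyC⟩ := ((hcover.adj_iff _ _).1 hAC).2
          exact ih fun x hx => hin _ y hyC x hx (hA y hyA)
      intro A
      obtain ⟨p⟩ := hconn.preconnected A₀ A
      exact hstep p fun x hx => hin A₀ r hr x hx (Reachable.refl _)
    refine connected_iff_exists_forall_reachable _ |>.2 ⟨r, fun x => ?_⟩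
    obtain ⟨A, hA⟩ := hcover.cover x
    exact hall A x hA

end InterDeg

/-- Transfer of `SQGC(c)` between classes along bounds that are linear in the treewidth and in the
size of the triangulated grid. -/
lemma SQGC.transfer {c : ℝ} (hc : 0 ≤ c) {𝒜 ℬ : Set FinGraph.{u}} {K d : ℕ} (hK : 0 < K)
    (h : ∀ H ∈ ℬ, ∃ G ∈ 𝒜, H.treewidth ≤ (d + 1) * (G.treewidth + 1) ∧
      ∀ t, 0 < t → (triangulatedGrid (K * t)).IsContraction G.simple →
        (triangulatedGrid t).IsContraction H.simple) (h𝒜 : SQGC c 𝒜) : SQGC c ℬ := by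
  obtain ⟨C, hC⟩ := h𝒜
  refine ⟨(d + 1) * (max C 0 * (K : ℝ) ^ c + 1), fun H hH t ht hno => ?_⟩
  obtain ⟨G, hG, htw, hcontr⟩ := h H hH
  have h1 := hC G hG (K * t) (ht.trans (Nat.le_mul_of_pos_left t hK))
    (fun h => hno (hcontr t (by omega) h))
  have h2 : (H.treewidth : ℝ) ≤ (d + 1) * (G.treewidth + 1) := by exact_mod_cast htw
  have ht1 : (1 : ℝ) ≤ (t : ℝ) ^ c := Real.one_le_rpow (by exact_mod_cast (by omega : 1 ≤ t)) hc
  rw [Nat.cast_mul, Real.mul_rpow (Nat.cast_nonneg K) (Nat.cast_nonneg t)] at h1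
  have h3 : C * ((K : ℝ) ^ c * (t : ℝ) ^ c) ≤ max C 0 * ((K : ℝ) ^ c * (t : ℝ) ^ c) :=
    mul_le_mul_of_nonneg_right (le_max_left _ _) (by positivity)
  calc (H.treewidth : ℝ) ≤ (d + 1) * (G.treewidth + 1) := h2
    _ ≤ (d + 1) * (max C 0 * ((K : ℝ) ^ c * (t : ℝ) ^ c) + (t : ℝ) ^ c) := by
      gcongr
      exact h1.trans h3
    _ = (d + 1) * (max C 0 * (K : ℝ) ^ c + 1) * (t : ℝ) ^ c := by ring

end FinGraph

theorem mainTheorem2 (c : ℝ) (hc₁ : 1 ≤ c) (hc₂ : c < 2) (d : ℕ)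
    (𝒢 : Set FinGraph.{u}) (hmono : FinGraph.IsMonotone 𝒢) :
    (FinGraph.SQGC c 𝒢 → FinGraph.SQGC c (FinGraph.interDeg d 𝒢)) ∧
    (FinGraph.SQGC c (FinGraph.connectedMembers 𝒢) →
      FinGraph.SQGC c (FinGraph.connectedMembers (FinGraph.interDeg d 𝒢))) := by
  have hK : 0 < SimpleGraph.gridFactor d := by
    unfold SimpleGraph.gridFactor
    omega
  refine ⟨FinGraph.SQGC.transfer (by linarith) hK (d := d) ?_,
    FinGraph.SQGC.transfer (by linarith) hK (d := d) ?_⟩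
  · rintro _ ⟨⟨G, hG, 𝒞, h𝒞, rfl⟩, hd⟩
    obtain ⟨F, hF, h1, h2, -⟩ := FinGraph.exists_subgraph_of_intersectionGraph h𝒞 hd
    exact ⟨_, hmono G hG F hF, h1, h2⟩
  · rintro _ ⟨⟨⟨G, hG, 𝒞, h𝒞, rfl⟩, hd⟩, hconn⟩
    obtain ⟨F, hF, h1, h2, h3⟩ := FinGraph.exists_subgraph_of_intersectionGraph h𝒞 hd
    exact ⟨_, ⟨hmono G hG F hF, h3 hconn⟩, h1, h2⟩
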